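/- Let $S^2$ be the unit sphere with round metric $h_{AB}$, volume form $\epsilon_{AB}$, Levi-Civita derivative $D_A$ (also written ${}_{||A}$), Laplacian $D^2$; integrals over $S^2$ use the area measure. Let $I\subset\mathbb R$ be an open set of retarded times $u$ (for instance an interval), a dot denoting $\partial_u$. Let $\chi_{AB}$ (symmetric, traceless), $m$, $N_A$ be smooth fields on $I\times S^2$ (shear tensor, mass aspect, angular aspect). Let $b,c$ be the smooth potentials of $\chi$, i.e. smooth functions on $I\times S^2$ without $l=0,1$ parts at each $u$ and such that $$\chi_{AB}=2c_{||AB}-h_{AB}D^2c+\epsilon_{AC}b^{||C}{}_{||B}+\epsilon_{BC}b^{||C}{}_{||A};$$ equivalently for $c$: $c$ is the unique solution of $D^2(D^2+2)c=\chi_{AB}{}^{||BA}$ without $l=0,1$ parts. Let $n$ be a linear combination of $l=1$ spherical harmonics. Define $$J^{(\mathrm{CJK})}=-\frac1{8\pi}\int_{S^2}\Big(3N_A+\tfrac14\chi_{AB}\chi^{BC}{}_{||C}\Big)\epsilon^{AD}n_{||D},\qquad J=J^{(\mathrm{CJK})}+\frac3{8\pi}\int_{S^2}m\,\epsilon^{AD}n_{||D}c_{||A}.$$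 (1) Suppose the data satisfy the evolution equations $$\dot m=-\tfrac18\dot\chi_{AB}\dot\chi^{AB}+\tfrac14\dot\chi^{AB}{}_{||BA},\qquad 3\dot N_A=-m_{||A}+\tfrac14\epsilon_{AB}\lambda^{||B}-\tfrac34\chi_{AB}\dot\chi^{BC}{}_{||C}-\tfrac14\dot\chi^{CD}\chi_{AC||D},$$ with $\lambda=h^{BD}\epsilon^{AC}\chi_{DA||BC}$. If $b=0$, then $$\dot J=\frac1{8\pi}\int_{S^2}\epsilon^{AD}n_{||D}\Big(3m\dot c_{||A}-\tfrac32c_{||A}\dot c^{||BC}\dot c_{||BC}+\tfrac34c_{||A}(D^2\dot c)^2+\tfrac14c_{||A}D^2(D^2+2)\dot c\Big).$$ (2) For smooth $f:S^2\to\mathbb R$, the supertranslation $u\mapsto u-f$ acts on the data, the fields being compared at the same point $(u,x)$, by $$\chi_{AB}\mapsto\chi_{AB}-2f_{||AB}+h_{AB}D^2f,$$ $$m\mapsto m+\tfrac12\dot\chi^{AB}{}_{||B}f_{||A}+\tfrac14\dot\chi^{AB}f_{||AB}+\tfrac14\ddot\chi^{AB}f_{||A}f_{||B},$$ $$\begin{aligned}N_A\mapsto{}&N_A-mf_{||A}+\tfrac14f_{||C}\chi_{AB}{}^{||BC}-\tfrac14f_{||C}\chi^{CB}{}_{||BA}+\tfrac14\dot\chi_{AB}{}^{||B}f_{||C}f^{||C}-\tfrac14\dot\chi^{BC}\chi_{AB}f_{||C}\\&-\tfrac16\ddot\chi^{BC}f_{||B}f_{||C}f_{||A}-\tfrac12\dot\chi^{BC}{}_{||C}f_{||B}f_{||A}+\tfrac1{12}\ddot\chi_{AB}f^{||B}f_{||C}f^{||C}.\end{aligned}$$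 Suppose $\dot\chi=0$ on $I$. Then, at every $u\in I$, $$J\longmapsto J+\frac1{32\pi}\int_{S^2}f\,n_{||A}D^AD^2(D^2+2)b,$$ with no term involving $m$, in both of the following senses: (a) for every smooth $f$, if the potential in the definition of $J$ is transformed by $c\mapsto c-f$; (b) for every smooth $f$ without $l=1$ part (that is, not containing a translation), if the potential in the transformed $J$ is the one determined by the transformed shear, i.e. the solution without $l=0,1$ parts. -/

import Mathlib

open scoped Manifold ContDiff Matrix

noncomputable section

namespace Scri

/-- Ambient Euclidean three-space. -/
abbrev E3 : Type := EuclideanSpace ℝ (Fin 3)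

/-- The round unit two-sphere. -/
abbrev S2 : Type := Metric.sphere (0 : E3) 1

/-- The standard area measure of the unit sphere (total mass `4π`). -/
def area : MeasureTheory.Measure S2 :=
  (MeasureTheory.volume : MeasureTheory.Measure E3).toSphere

/-! ### Tensor calculus on the round sphere

A covariant tensor field on `S2` is represented by its Cartesian components: a one-form is a map
`v : S2 → Fin 3 → ℝ`, a rank-two tensor a map `T : S2 → Fin 3 → Fin 3 → ℝ`, and so on, where each
index is tangential, i.e. annihilated by contraction with the position vector `x`. On tangential
indices the round metric is the restriction of the Euclidean metric, so raising an index does not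
change components and every contraction is a plain sum over `Fin 3`. The Levi-Civita derivative of
the submanifold `S2` of Euclidean space is the tangential derivative of the components followed by
orthogonal projection of all indices onto the tangent plane. The index produced by differentiation
is always the last one: `covD1 v x A B` is `v_{A||B}`. -/

lemma normalize_mem {y : E3} (hy : y ≠ 0) : ‖y‖⁻¹ • y ∈ Metric.sphere (0 : E3) 1 := by
  simp [norm_smul, hy]

open Classical in
/-- The extension of a function on the sphere which is constant along rays from the origin. -/
def radialExt (F : S2 → ℝ) (y : E3) : ℝ :=
  if hy : y ≠ 0 then F ⟨‖y‖⁻¹ • y, normalize_mem hy⟩ else 0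

/-- Cartesian components `f_{||A}` of the differential of a function on the sphere. -/
def grad (f : S2 → ℝ) (x : S2) (A : Fin 3) : ℝ :=
  fderiv ℝ (radialExt f) (x : E3) (EuclideanSpace.single A 1)

/-- The round metric `h_{AB}`, which is also the orthogonal projection on the tangent plane. -/
def metric (x : S2) (A B : Fin 3) : ℝ :=
  (if A = B then 1 else 0) - (x : E3) A * (x : E3) B

/-- The volume form `ε_{AB}`: the triple product of `e_A`, `e_B` and the outward normal. -/
def vol (x : S2) (A B : Fin 3) : ℝ :=
  (Matrix.of ![Pi.single A 1, Pi.single B 1, fun k => (x : E3) k]).det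

/-- `v_{A||B}` for a one-form `v`. -/
def covD1 (v : S2 → Fin 3 → ℝ) (x : S2) (A B : Fin 3) : ℝ :=
  ∑ a, metric x A a * grad (fun y => v y a) x B

/-- `T_{AB||C}` for a rank-two tensor `T`. -/
def covD2 (T : S2 → Fin 3 → Fin 3 → ℝ) (x : S2) (A B C : Fin 3) : ℝ :=
  ∑ a, ∑ b, metric x A a * metric x B b * grad (fun y => T y a b) x C

/-- `T_{ABC||D}` for a rank-three tensor `T`. -/
def covD3 (T : S2 → Fin 3 → Fin 3 → Fin 3 → ℝ) (x : S2) (A B C D : Fin 3) : ℝ :=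
  ∑ a, ∑ b, ∑ c, metric x A a * metric x B b * metric x C c * grad (fun y => T y a b c) x D

/-- The Hessian `f_{||AB}`. -/
def hess (f : S2 → ℝ) : S2 → Fin 3 → Fin 3 → ℝ := covD1 (grad f)

/-- The Laplacian `D² f`. -/
def lap (f : S2 → ℝ) (x : S2) : ℝ := ∑ A, hess f x A A

/-- The operator `D² (D² + 2)` on functions. -/
def lapLap2 (f : S2 → ℝ) : S2 → ℝ := lap (fun x => lap f x + 2 * f x)

/-- Second covariant derivative `T_{AB||CD}` of a rank-two tensor. -/
def covDD2 (T : S2 → Fin 3 → Fin 3 → ℝ) : S2 → Fin 3 → Fin 3 → Fin 3 → Fin 3 → ℝ :=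
  covD3 (covD2 T)

/-- The divergence `T_{AB}^{||B}` of a rank-two tensor. -/
def div2 (T : S2 → Fin 3 → Fin 3 → ℝ) (x : S2) (A : Fin 3) : ℝ := ∑ B, covD2 T x A B B

/-- The general linear combination of `l = 1` spherical harmonics. -/
def dipole (a : E3) (x : S2) : ℝ := inner ℝ a (x : E3)

/-- The function has no `l = 0` part. -/
def NoMonopole (f : S2 → ℝ) : Prop := ∫ x, f x ∂area = 0

/-- The function has no `l = 1` part. -/
def NoDipole (f : S2 → ℝ) : Prop := ∀ i : Fin 3, ∫ x, f x * (x : E3) i ∂area = 0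

/-- Smooth functions on the sphere. -/
def Smooth (f : S2 → ℝ) : Prop := ContMDiff (𝓡 2) 𝓘(ℝ, ℝ) ∞ f

/-- Functions of `(u, x)` that are jointly smooth for `u ∈ I`. -/
def SmoothOn (I : Set ℝ) (F : ℝ → S2 → ℝ) : Prop :=
  ContMDiffOn (𝓘(ℝ, ℝ).prod (𝓡 2)) 𝓘(ℝ, ℝ) ∞ (fun p : ℝ × S2 => F p.1 p.2) (I ×ˢ Set.univ)

/-! ### Data on null infinity -/

/-- Fields on null infinity: shear `χ_{AB}`, mass aspect `m`, angular aspect `N_A`,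
as functions of the retarded time and of the point of the sphere. -/
structure ScriData where
  χ : ℝ → S2 → Fin 3 → Fin 3 → ℝ
  m : ℝ → S2 → ℝ
  N : ℝ → S2 → Fin 3 → ℝ

/-- `χ`, `m` and `N` are smooth tensor fields for `u ∈ I`, and `χ` is symmetric and traceless. -/
structure IsScriData (I : Set ℝ) (d : ScriData) : Prop where
  smooth_χ : ∀ A B, SmoothOn I (fun u x => d.χ u x A B)
  smooth_m : SmoothOn I d.m
  smooth_N : ∀ A, SmoothOn I (fun u x => d.N u x A)
  tangent_χ : ∀ u ∈ I, ∀ x : S2, ∀ A, ∑ B, d.χ u x A B * (x : E3) B = 0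
  tangent_N : ∀ u ∈ I, ∀ x : S2, ∑ A, d.N u x A * (x : E3) A = 0
  symm : ∀ u ∈ I, ∀ x : S2, ∀ A B, d.χ u x A B = d.χ u x B A
  traceless : ∀ u ∈ I, ∀ x : S2, ∑ A, d.χ u x A A = 0

/-- `∂_u χ_{AB}`. -/
def ScriData.χdot (d : ScriData) (u : ℝ) (x : S2) (A B : Fin 3) : ℝ :=
  deriv (fun s => d.χ s x A B) u

/-- `∂_u² χ_{AB}`. -/
def ScriData.χddot (d : ScriData) (u : ℝ) (x : S2) (A B : Fin 3) : ℝ :=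
  deriv (fun s => d.χdot s x A B) u

/-- The scalar `λ = h^{BD} ε^{AC} χ_{DA||BC}`. -/
def ScriData.lam (d : ScriData) (u : ℝ) (x : S2) : ℝ :=
  ∑ A, ∑ B, ∑ C, vol x A C * covDD2 (d.χ u) x B A B C

/-- The evolution equations of the mass aspect and of the angular aspect. -/
structure SatisfiesEvolution (I : Set ℝ) (d : ScriData) : Prop where
  m_dot : ∀ u ∈ I, ∀ x, deriv (fun s => d.m s x) u =
    -(1 / 8) * (∑ A, ∑ B, d.χdot u x A B * d.χdot u x A B)
      + 1 / 4 * ∑ A, ∑ B, covDD2 (d.χdot u) x A B B A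
  N_dot : ∀ u ∈ I, ∀ x, ∀ A, 3 * deriv (fun s => d.N s x A) u =
    -grad (d.m u) x A
      + 1 / 4 * (∑ B, vol x A B * grad (d.lam u) x B)
      - 3 / 4 * (∑ B, d.χ u x A B * div2 (d.χdot u) x B)
      - 1 / 4 * ∑ C, ∑ D, d.χdot u x C D * covD2 (d.χ u) x A C D

/-- The action of the supertranslation `u ↦ u - f` on the data. The transformed fields at a point
of null infinity are expressed through the original fields at the same point, so that both are
regarded as functions of the same labels `(u, x)`. -/
def ScriData.supertranslate (f : S2 → ℝ) (d : ScriData) : ScriData where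
  χ u x A B := d.χ u x A B - 2 * hess f x A B + metric x A B * lap f x
  m u x := d.m u x
    + 1 / 2 * (∑ A, div2 (d.χdot u) x A * grad f x A)
    + 1 / 4 * (∑ A, ∑ B, d.χdot u x A B * hess f x A B)
    + 1 / 4 * (∑ A, ∑ B, d.χddot u x A B * grad f x A * grad f x B)
  N u x A := d.N u x A - d.m u x * grad f x A
    + 1 / 4 * (∑ B, ∑ C, grad f x C * covDD2 (d.χ u) x A B B C)
    - 1 / 4 * (∑ B, ∑ C, grad f x C * covDD2 (d.χ u) x C B B A)
    + 1 / 4 * (div2 (d.χdot u) x A * ∑ C, grad f x C * grad f x C)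
    - 1 / 4 * (∑ B, ∑ C, d.χdot u x B C * d.χ u x A B * grad f x C)
    - 1 / 6 * ((∑ B, ∑ C, d.χddot u x B C * grad f x B * grad f x C) * grad f x A)
    - 1 / 2 * ((∑ B, div2 (d.χdot u) x B * grad f x B) * grad f x A)
    + 1 / 12 * ((∑ B, d.χddot u x A B * grad f x B) * ∑ C, grad f x C * grad f x C)

/-! ### Potentials of the shear -/

/-- The symmetric traceless tensor
`2 c_{||AB} - h_{AB} D² c + ε_{AC} b^{||C}_{||B} + ε_{BC} b^{||C}_{||A}`. -/
def tensorOfPotentials (c b : S2 → ℝ) (x : S2) (A B : Fin 3) : ℝ :=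
  2 * hess c x A B - metric x A B * lap c x
    + (∑ C, vol x A C * hess b x C B) + ∑ C, vol x B C * hess b x C A

/-- `c` and `b` are the potentials of the tensor `T`. -/
structure ArePotentials (T : S2 → Fin 3 → Fin 3 → ℝ) (c b : S2 → ℝ) : Prop where
  smooth_c : Smooth c
  smooth_b : Smooth b
  c_noMonopole : NoMonopole c
  c_noDipole : NoDipole c
  b_noMonopole : NoMonopole b
  b_noDipole : NoDipole b
  eq : ∀ x A B, T x A B = tensorOfPotentials c b x A B

/-- `c` is smooth, has no `l = 0, 1` parts and solves `D² (D² + 2) c = T_{AB}^{||BA}`. -/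
structure IsElectricPotential (T : S2 → Fin 3 → Fin 3 → ℝ) (c : S2 → ℝ) : Prop where
  smooth : Smooth c
  noMonopole : NoMonopole c
  noDipole : NoDipole c
  eq : ∀ x, lapLap2 c x = ∑ A, ∑ B, covDD2 T x A B B A

open Classical in
/-- The solution `c` of `D² (D² + 2) c = T_{AB}^{||BA}` with no `l = 0, 1` parts. -/
def electricPotential (T : S2 → Fin 3 → Fin 3 → ℝ) : S2 → ℝ :=
  if h : ∃ c, IsElectricPotential T c then h.choose else 0

/-! ### Angular momentum -/

/-- The rotation field `ε^{AD} n_{||D}` of the dipole function `n = dipole a`. -/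
def rot (a : E3) (x : S2) (A : Fin 3) : ℝ := ∑ D, vol x A D * grad (dipole a) x D

/-- The angular momentum `J^(CJK)` at retarded time `u` for `n = dipole a`. -/
def JCJK (a : E3) (d : ScriData) (u : ℝ) : ℝ :=
  -(1 / (8 * Real.pi)) * ∫ x, ∑ A,
    (3 * d.N u x A + 1 / 4 * ∑ B, d.χ u x A B * div2 (d.χ u) x B) * rot a x A ∂area

/-- `J^(CJK) + (3/8π) ∫ m ε^{AD} n_{||D} c_{||A}`, with the potential `c` given explicitly. -/
def JWith (a : E3) (d : ScriData) (u : ℝ) (c : S2 → ℝ) : ℝ :=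
  JCJK a d u + 3 / (8 * Real.pi) * ∫ x, d.m u x * ∑ A, rot a x A * grad c x A ∂area

/-- The new angular momentum `J`: here `c` is the potential determined by the shear. -/
def J (a : E3) (d : ScriData) (u : ℝ) : ℝ := JWith a d u (electricPotential (d.χ u))

end Scri

end

/-!
Tensors are written in Cartesian components. The only analytic input is `∫ δ_A f = 2 ∫ x_A f` for
the tangential derivations `δ_A`; tensor identities become polynomial identities in `x_A` and `δ_A`.

The rotation field `ε^{AD} n_{||D}` is divergence free and its symmetrised derivative vanishes, so a
divergence contracted with it integrates to zero. The divergence of the shear with potentials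
`c`, `b` is the gradient of `(D² + 2) c` plus the curl of `(D² + 2) b`, and `D² (D² + 2)` kills
exactly the `l = 0, 1` modes, so `c` is determined by the shear. For a stationary shear the terms of
`J` bilinear in `f`, `c` cancel after integration by parts and those bilinear in `f`, `b` are left;
the terms with `m` cancel because `c` is shifted by `f`. For `b = 0` one has `λ = 0`, and the flux
follows by differentiating under the integral and integrating the quadratic terms by parts.
-/

noncomputable section

namespace Scri

lemma mulVec_dotProduct_comm {n R : Type*} [Fintype n] [CommSemiring R] {T : Matrix n n R}
    (hT : T.IsSymm) (v w : n → R) : T *ᵥ v ⬝ᵥ w = T *ᵥ w ⬝ᵥ v := by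
  rw [dotProduct_comm, Matrix.dotProduct_mulVec, ← Matrix.mulVec_transpose, hT]

/-- A commutative algebra with the Cartesian coordinates `x`, the tangential derivations `δ` and
the integral of the round two-sphere. Tensors are represented by their Cartesian components, whose
indices are annihilated by `x`. -/
structure SphereCalculus (𝒜 : Type*) [CommRing 𝒜] [Algebra ℝ 𝒜] where
  x : Fin 3 → 𝒜
  δ : Fin 3 → Derivation ℝ 𝒜 𝒜
  int : 𝒜 →ₗ[ℝ] ℝ
  x_dotProduct_x : x ⬝ᵥ x = 1
  x_dotProduct_δ : ∀ f, (x ⬝ᵥ fun A => δ A f) = 0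
  δ_x : ∀ A B, δ A (x B) = (if B = A then 1 else 0) - x B * x A
  δ_comm : ∀ A B f, δ A (δ B f) = δ B (δ A f) + (x A * δ B f - x B * δ A f)
  int_δ : ∀ A f, int (δ A f) = int (2 • (x A * f))

namespace SphereCalculus

variable {𝒜 : Type*} [CommRing 𝒜] [Algebra ℝ 𝒜] (S : SphereCalculus 𝒜)

/-- The round metric, which is also the orthogonal projection on the tangent plane. -/
def h : Matrix (Fin 3) (Fin 3) 𝒜 := Matrix.of fun A B => (if A = B then 1 else 0) - S.x A * S.x B

/-- The volume form; `ε *ᵥ v` is the cross product of `v` with the outward normal `x`. -/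
def ε : Matrix (Fin 3) (Fin 3) 𝒜 := !![0, S.x 2, -S.x 1; -S.x 2, 0, S.x 0; S.x 1, -S.x 0, 0]

/-- The differential of a function. -/
def grad : 𝒜 →ₗ[ℝ] Fin 3 → 𝒜 := LinearMap.pi fun A => S.δ A

/-- The matrix `δ_B v_A` of the tangential derivatives of the Cartesian components of `v`. -/
def jac : (Fin 3 → 𝒜) →ₗ[ℝ] Matrix (Fin 3) (Fin 3) 𝒜 where
  toFun v := Matrix.of fun A B => S.δ B (v A)
  map_add' v w := by ext; simp
  map_smul' r v := by ext; simp

/-- The covariant derivative `v_{A||B}` of a one-form; the derivative index is the last one. -/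
def covD1 : (Fin 3 → 𝒜) →ₗ[ℝ] Matrix (Fin 3) (Fin 3) 𝒜 := LinearMap.mulLeft ℝ S.h ∘ₗ S.jac

/-- The covariant derivative `T_{AB||C}` of a rank-two tensor. -/
def covD2 (T : Matrix (Fin 3) (Fin 3) 𝒜) (A B C : Fin 3) : 𝒜 :=
  ∑ a, ∑ b, S.h A a * S.h B b * S.δ C (T a b)

/-- The covariant derivative `T_{ABC||D}` of a rank-three tensor. -/
def covD3 (T : Fin 3 → Fin 3 → Fin 3 → 𝒜) (A B C D : Fin 3) : 𝒜 :=
  ∑ a, ∑ b, ∑ c, S.h A a * S.h B b * S.h C c * S.δ D (T a b c)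

/-- The divergence of a one-form. -/
def div1 : (Fin 3 → 𝒜) →ₗ[ℝ] 𝒜 := Matrix.traceLinearMap (Fin 3) ℝ 𝒜 ∘ₗ S.covD1

/-- The divergence `T_{AB}^{||B}` of a rank-two tensor. -/
def div2 : Matrix (Fin 3) (Fin 3) 𝒜 →ₗ[ℝ] Fin 3 → 𝒜 where
  toFun T A := ∑ B, S.covD2 T A B B
  map_add' T T' := by ext; simp [covD2, mul_add, Finset.sum_add_distrib]
  map_smul' r T := by ext; simp [covD2, Finset.smul_sum]

/-- The Hessian `f_{||AB}`. -/
def hess : 𝒜 →ₗ[ℝ] Matrix (Fin 3) (Fin 3) 𝒜 := S.covD1 ∘ₗ S.grad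

/-- The Laplacian `D²`. -/
def lap : 𝒜 →ₗ[ℝ] 𝒜 := S.div1 ∘ₗ S.grad

/-- The operator `D² + 2`, whose kernel is spanned by the `l = 1` harmonics. -/
def lapAddTwo : 𝒜 →ₗ[ℝ] 𝒜 := S.lap + 2 • LinearMap.id

/-- The rotated differential `ε_{AB} f^{||B}`. -/
def curl : 𝒜 →ₗ[ℝ] Fin 3 → 𝒜 := (Matrix.mulVecLin S.ε).restrictScalars ℝ ∘ₗ S.grad

/-- The directional derivative along a vector field. -/
def dirDeriv (v : Fin 3 → 𝒜) : Derivation ℝ 𝒜 𝒜 := ∑ A, v A • S.δ A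

/-- The symmetric traceless tensor `2 c_{||AB} - h_{AB} D² c` with electric potential `c`. -/
def electric : 𝒜 →ₗ[ℝ] Matrix (Fin 3) (Fin 3) 𝒜 := 2 • S.hess - S.lap.smulRight S.h

/-- The symmetric traceless tensor with magnetic potential `b`, written as the dual of an electric
tensor; `magnetic_eq` is the paper's form `ε_{AC} b^{||C}_{||B} + ε_{BC} b^{||C}_{||A}`. -/
def magnetic : 𝒜 →ₗ[ℝ] Matrix (Fin 3) (Fin 3) 𝒜 := LinearMap.mulLeft ℝ S.ε ∘ₗ S.electric

/-- The symmetric traceless tensor with electric potential `c` and magnetic potential `b`. -/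
def tensorOfPotentials (c b : 𝒜) : Matrix (Fin 3) (Fin 3) 𝒜 := S.electric c + S.magnetic b

/-- Symmetric traceless tangential tensors of rank two. -/
structure IsSTF (T : Matrix (Fin 3) (Fin 3) 𝒜) : Prop where
  isSymm : T.IsSymm
  mulVec_x : T *ᵥ S.x = 0
  trace_eq_zero : T.trace = 0

@[simp] lemma grad_apply (f : 𝒜) (A : Fin 3) : S.grad f A = S.δ A f := rfl

@[simp] lemma jac_apply (v : Fin 3 → 𝒜) (A B : Fin 3) : S.jac v A B = S.δ B (v A) := rfl

lemma covD1_eq (v : Fin 3 → 𝒜) : S.covD1 v = S.h * S.jac v := rfl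

lemma hess_eq_covD1_grad (f : 𝒜) : S.hess f = S.covD1 (S.grad f) := rfl

lemma lap_eq_div1_grad (f : 𝒜) : S.lap f = S.div1 (S.grad f) := rfl

lemma trace_covD1 (v : Fin 3 → 𝒜) : (S.covD1 v).trace = S.div1 v := rfl

lemma trace_hess (f : 𝒜) : (S.hess f).trace = S.lap f := rfl

lemma lapAddTwo_apply (f : 𝒜) : S.lapAddTwo f = S.lap f + 2 • f := rfl

lemma curl_eq (f : 𝒜) : S.curl f = S.ε *ᵥ S.grad f := rfl

lemma electric_eq (c : 𝒜) : S.electric c = 2 • S.hess c - S.lap c • S.h := rfl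

lemma dirDeriv_apply (v : Fin 3 → 𝒜) (f : 𝒜) : S.dirDeriv v f = v ⬝ᵥ S.grad f := by
  simp [dirDeriv, dotProduct, Fin.sum_univ_three]

lemma sum_x_sq : S.x 0 * S.x 0 + S.x 1 * S.x 1 + S.x 2 * S.x 2 = 1 := by
  rw [← S.x_dotProduct_x, Matrix.vec3_dotProduct]

lemma x_dotProduct_grad (f : 𝒜) : S.x ⬝ᵥ S.grad f = 0 := S.x_dotProduct_δ f

lemma sum_x_mul_δ (f : 𝒜) : S.x 0 * S.δ 0 f + S.x 1 * S.δ 1 f + S.x 2 * S.δ 2 f = 0 := by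
  rw [← S.x_dotProduct_δ f, Matrix.vec3_dotProduct]

/-! ### Algebra of tangential tensors -/

lemma h_eq_sub : S.h = 1 - Matrix.vecMulVec S.x S.x := by
  ext A B; simp [h, Matrix.one_apply, Matrix.vecMulVec_apply]

lemma h_isSymm : S.h.IsSymm := by
  rw [h_eq_sub, Matrix.IsSymm]; simp

lemma h_mulVec_x : S.h *ᵥ S.x = 0 := by
  simp [h_eq_sub, Matrix.sub_mulVec, Matrix.vecMulVec_mulVec, S.x_dotProduct_x]

lemma trace_h : S.h.trace = 2 := by
  rw [h_eq_sub, Matrix.trace_sub, Matrix.trace_vecMulVec, S.x_dotProduct_x]; norm_num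

lemma ε_transpose : S.εᵀ = -S.ε := by
  ext A B; fin_cases A <;> fin_cases B <;> simp [ε]

lemma ε_mul_ε : S.ε * S.ε = -S.h := by
  have hx := S.sum_x_sq
  ext A B; fin_cases A <;> fin_cases B <;>
    simp [ε, h, Matrix.mul_apply, Fin.sum_univ_three] <;> grind

lemma ε_mulVec_x : S.ε *ᵥ S.x = 0 := by
  ext A
  rw [Matrix.mulVec, Matrix.vec3_dotProduct]
  fin_cases A <;> simp [ε] <;> ring

variable {S} in
lemma h_mulVec {v : Fin 3 → 𝒜} (hv : S.x ⬝ᵥ v = 0) : S.h *ᵥ v = v := by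
  simp [h_eq_sub, Matrix.sub_mulVec, Matrix.vecMulVec_mulVec, hv]

variable {S} in
lemma h_mulVec_sub_smul_x {v : Fin 3 → 𝒜} (hv : S.x ⬝ᵥ v = 0) (r : 𝒜) :
    S.h *ᵥ (v - r • S.x) = v := by
  rw [Matrix.mulVec_sub, Matrix.mulVec_smul, h_mulVec_x, h_mulVec hv, smul_zero, sub_zero]

lemma h_mul_h : S.h * S.h = S.h := by
  simp [h_eq_sub, sub_mul, mul_sub, Matrix.vecMulVec_mul_vecMulVec, S.x_dotProduct_x]

variable {S} in
lemma mul_h {T : Matrix (Fin 3) (Fin 3) 𝒜} (hT : T *ᵥ S.x = 0) : T * S.h = T := by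
  rw [h_eq_sub, mul_sub, mul_one, Matrix.mul_vecMulVec, hT]; simp

lemma ε_mul_h : S.ε * S.h = S.ε := mul_h S.ε_mulVec_x

lemma x_dotProduct_ε_mulVec (v : Fin 3 → 𝒜) : S.x ⬝ᵥ S.ε *ᵥ v = 0 := by
  simp only [Matrix.mulVec, Matrix.vec3_dotProduct]; simp [ε]; ring

lemma ε_mulVec_dotProduct (v w : Fin 3 → 𝒜) : S.ε *ᵥ v ⬝ᵥ w = -(v ⬝ᵥ S.ε *ᵥ w) := by
  rw [Matrix.dotProduct_mulVec, ← Matrix.mulVec_transpose, ε_transpose, Matrix.neg_mulVec,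
    neg_dotProduct, neg_neg]

variable {S} in
lemma trace_mul_ε {T : Matrix (Fin 3) (Fin 3) 𝒜} (hT : T.IsSymm) : (T * S.ε).trace = 0 := by
  have hsymm10 := hT.apply 0 1
  have hsymm20 := hT.apply 0 2
  have hsymm21 := hT.apply 1 2
  simp [Matrix.trace, Matrix.mul_apply, Fin.sum_univ_three, ε, hsymm10, hsymm20, hsymm21]
  ring

variable {S} in
lemma sum_mul_x {T : Matrix (Fin 3) (Fin 3) 𝒜} (hT : T *ᵥ S.x = 0) (A : Fin 3) :
    T A 0 * S.x 0 + T A 1 * S.x 1 + T A 2 * S.x 2 = 0 := by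
  rw [← Matrix.vec3_dotProduct]
  exact congrFun hT A

variable {S} in
lemma ε_mul_sub_transpose {T : Matrix (Fin 3) (Fin 3) 𝒜} (hT : T.IsSymm) (hx : T *ᵥ S.x = 0) :
    S.ε * T - (S.ε * T)ᵀ = T.trace • S.ε := by
  have hsymm10 := hT.apply 0 1
  have hsymm20 := hT.apply 0 2
  have hsymm21 := hT.apply 1 2
  have hx0 := sum_mul_x hx 0
  have hx1 := sum_mul_x hx 1
  have hx2 := sum_mul_x hx 2
  ext A B
  fin_cases A <;> fin_cases B <;>
    simp [Matrix.trace, Fin.sum_univ_three, ε, Matrix.vecMul, Matrix.vecHead, Matrix.vecTail] <;>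
    grind

/-! ### Covariant derivatives of functions and one-forms -/

lemma jac_mulVec_x (v : Fin 3 → 𝒜) : S.jac v *ᵥ S.x = 0 := by
  ext A
  rw [Matrix.mulVec, dotProduct_comm, Pi.zero_apply, ← S.x_dotProduct_δ (v A)]
  rfl

variable {S} in
lemma x_vecMul_jac {v : Fin 3 → 𝒜} (hv : S.x ⬝ᵥ v = 0) : S.x ᵥ* S.jac v = -v := by
  ext B
  have hδ : S.δ B (S.x ⬝ᵥ v) = (S.h *ᵥ v) B + (S.x ᵥ* S.jac v) B := by
    simp [dotProduct, Matrix.mulVec, Matrix.vecMul, h, S.δ_x, Finset.sum_add_distrib, mul_comm,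
      eq_comm]
  rw [hv, map_zero, h_mulVec hv] at hδ
  exact eq_neg_of_add_eq_zero_right hδ.symm

variable {S} in
lemma covD1_apply {v : Fin 3 → 𝒜} (hv : S.x ⬝ᵥ v = 0) (A B : Fin 3) :
    S.covD1 v A B = S.δ B (v A) + S.x A * v B := by
  rw [covD1_eq, h_eq_sub, sub_mul, one_mul, Matrix.vecMulVec_mul, x_vecMul_jac hv]
  simp [Matrix.vecMulVec_apply]

lemma covD1_mulVec_x (v : Fin 3 → 𝒜) : S.covD1 v *ᵥ S.x = 0 := by
  rw [covD1_eq, ← Matrix.mulVec_mulVec, jac_mulVec_x, Matrix.mulVec_zero]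

lemma div1_eq_sum (v : Fin 3 → 𝒜) : S.div1 v = ∑ A, S.δ A (v A) := by
  rw [← trace_covD1, covD1_eq, Matrix.trace_mul_comm, mul_h (S.jac_mulVec_x v)]
  rfl

lemma div1_smul (f : 𝒜) (v : Fin 3 → 𝒜) : S.div1 (f • v) = f * S.div1 v + v ⬝ᵥ S.grad f := by
  simp only [div1_eq_sum, Fin.sum_univ_three, Matrix.vec3_dotProduct, grad_apply, Pi.smul_apply,
    smul_eq_mul, Derivation.leibniz]
  ring

lemma grad_mul (f g : 𝒜) : S.grad (f * g) = f • S.grad g + g • S.grad f := by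
  ext A; simp

lemma grad_x (A : Fin 3) : S.grad (S.x A) = S.h A := by
  ext B; simp [S.δ_x, h]

lemma hess_apply (f : 𝒜) (A B : Fin 3) :
    S.hess f A B = S.δ B (S.δ A f) + S.x A * S.δ B f :=
  covD1_apply (S.x_dotProduct_grad f) A B

lemma hess_isSymm (f : 𝒜) : (S.hess f).IsSymm := by
  ext A B
  rw [Matrix.transpose_apply, hess_apply, hess_apply, S.δ_comm A B]
  ring

lemma hess_mulVec_x (f : 𝒜) : S.hess f *ᵥ S.x = 0 := S.covD1_mulVec_x _

lemma lap_eq_sum (f : 𝒜) : S.lap f = ∑ A, S.δ A (S.δ A f) := S.div1_eq_sum _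

lemma lap_mul (f g : 𝒜) :
    S.lap (f * g) = f * S.lap g + g * S.lap f + 2 * (S.grad f ⬝ᵥ S.grad g) := by
  rw [lap_eq_div1_grad, grad_mul, map_add, div1_smul, div1_smul, ← lap_eq_div1_grad,
    ← lap_eq_div1_grad, dotProduct_comm (S.grad g)]
  ring

lemma sum_δ_mul_x (f : 𝒜) : ∑ A, S.δ A (f * S.x A) = 2 * f := by
  have hf := S.sum_x_mul_δ f
  have hx := S.sum_x_sq
  simp only [Fin.sum_univ_three, Derivation.leibniz, S.δ_x, smul_eq_mul, if_true]
  linear_combination hf - f * hx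

lemma lap_x (A : Fin 3) : S.lap (S.x A) = -(2 * S.x A) := by
  rw [lap_eq_div1_grad, grad_x, div1_eq_sum, ← S.sum_δ_mul_x, ← Finset.sum_neg_distrib]
  refine Finset.sum_congr rfl fun B _ => ?_
  rw [h, Matrix.of_apply, map_sub, apply_ite (S.δ B)]
  simp

lemma grad_dotProduct_grad_x (f : 𝒜) (A : Fin 3) : S.grad f ⬝ᵥ S.grad (S.x A) = S.δ A f := by
  rw [grad_x, dotProduct_comm]
  exact congrFun (h_mulVec (S.x_dotProduct_grad f)) A

lemma div1_x_smul_grad (f : 𝒜) (A : Fin 3) :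
    S.div1 (S.x A • S.grad f) = S.x A * S.lap f + S.δ A f := by
  rw [div1_smul, grad_dotProduct_grad_x, lap_eq_div1_grad]

lemma lap_δ (A : Fin 3) (f : 𝒜) :
    S.lap (S.δ A f) = S.δ A (S.lap f) - 2 * (S.x A * S.lap f) := by
  have houter (B) : S.δ B (S.δ B (S.δ A f)) = S.δ B (S.δ A (S.δ B f)) +
      (S.δ B (S.δ A f * S.x B) - S.δ B (S.x A * S.δ B f)) := by
    rw [S.δ_comm B A, map_add, map_sub, mul_comm (S.x B)]
  have hinner : ∑ B, S.δ B (S.δ A (S.δ B f)) = S.δ A (S.lap f) - S.δ A f - S.x A * S.lap f := by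
    have hx := congrFun (x_vecMul_jac (S.x_dotProduct_grad f)) A
    simp only [Matrix.vecMul, dotProduct, jac_apply, grad_apply, Pi.neg_apply] at hx
    rw [lap_eq_sum, map_sum, Finset.mul_sum, sub_eq_add_neg (∑ _, _), ← hx,
      ← Finset.sum_add_distrib, ← Finset.sum_sub_distrib]
    exact Finset.sum_congr rfl fun B _ => by rw [S.δ_comm B A]; ring
  have hlast : ∑ B, S.δ B (S.x A * S.δ B f) = S.x A * S.lap f + S.δ A f := by
    rw [← div1_x_smul_grad, div1_eq_sum]
    rfl
  rw [lap_eq_sum, Finset.sum_congr rfl fun B _ => houter B, Finset.sum_add_distrib,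
    Finset.sum_sub_distrib, hinner, sum_δ_mul_x, hlast]
  ring

lemma x_dotProduct_curl (f : 𝒜) : S.x ⬝ᵥ S.curl f = 0 := S.x_dotProduct_ε_mulVec _

variable {S} in
lemma covD1_ε_mulVec {v : Fin 3 → 𝒜} (hv : S.x ⬝ᵥ v = 0) :
    S.covD1 (S.ε *ᵥ v) = S.ε * S.covD1 v := by
  have hx := S.sum_x_sq
  rw [S.covD1_eq v, ← mul_assoc, ε_mul_h]
  ext A B
  rw [covD1_apply (S.x_dotProduct_ε_mulVec v)]
  simp only [Matrix.mulVec, Matrix.vec3_dotProduct, Matrix.mul_apply, Fin.sum_univ_three,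
    jac_apply, map_add, Derivation.leibniz, smul_eq_mul] at hv ⊢
  fin_cases A <;> fin_cases B <;> simp [ε, S.δ_x] <;> grind

lemma covD1_curl (f : 𝒜) : S.covD1 (S.curl f) = S.ε * S.hess f :=
  covD1_ε_mulVec (S.x_dotProduct_grad f)

lemma div1_curl (f : 𝒜) : S.div1 (S.curl f) = 0 := by
  rw [← trace_covD1, covD1_curl, Matrix.trace_mul_comm, trace_mul_ε (S.hess_isSymm f)]

/-! ### Symmetric traceless tensors and their divergences -/

variable {S} in
lemma IsSTF.ε_mul {T : Matrix (Fin 3) (Fin 3) 𝒜} (hT : S.IsSTF T) : S.IsSTF (S.ε * T) where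
  isSymm := by
    have hanti := ε_mul_sub_transpose hT.isSymm hT.mulVec_x
    rw [hT.trace_eq_zero, zero_smul, sub_eq_zero] at hanti
    exact hanti.symm
  mulVec_x := by rw [← Matrix.mulVec_mulVec, hT.mulVec_x, Matrix.mulVec_zero]
  trace_eq_zero := by rw [Matrix.trace_mul_comm, trace_mul_ε hT.isSymm]

variable {S} in
lemma IsSTF.h_mul {T : Matrix (Fin 3) (Fin 3) 𝒜} (hT : S.IsSTF T) : S.h * T = T := by
  have h_transpose := congrArg Matrix.transpose (mul_h hT.mulVec_x)
  rwa [Matrix.transpose_mul, hT.isSymm, S.h_isSymm] at h_transpose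

lemma isSTF_electric (c : 𝒜) : S.IsSTF (S.electric c) where
  isSymm := ((S.hess_isSymm c).smul 2).sub (S.h_isSymm.smul _)
  mulVec_x := by
    rw [electric_eq, Matrix.sub_mulVec, Matrix.smul_mulVec, Matrix.smul_mulVec, hess_mulVec_x,
      h_mulVec_x, smul_zero, smul_zero, sub_zero]
  trace_eq_zero := by
    simp only [electric_eq, Matrix.trace_sub, Matrix.trace_smul, trace_hess, trace_h, smul_eq_mul]
    ring

lemma electric_algebraMap (r : ℝ) : S.electric (algebraMap ℝ 𝒜 r) = 0 := by
  have hgrad : S.grad (algebraMap ℝ 𝒜 r) = 0 := funext fun A => (S.δ A).map_algebraMap r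
  rw [electric_eq, hess_eq_covD1_grad, lap_eq_div1_grad, hgrad, map_zero, map_zero, smul_zero,
    zero_smul, sub_zero]

lemma magnetic_eq_ε_mul (b : 𝒜) : S.magnetic b = S.ε * S.electric b := rfl

lemma isSTF_magnetic (b : 𝒜) : S.IsSTF (S.magnetic b) := (S.isSTF_electric b).ε_mul

lemma magnetic_eq (b : 𝒜) : S.magnetic b = S.ε * S.hess b + (S.ε * S.hess b)ᵀ := by
  have hanti := ε_mul_sub_transpose (S.hess_isSymm b) (S.hess_mulVec_x b)
  rw [trace_hess, sub_eq_iff_eq_add] at hanti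
  rw [magnetic_eq_ε_mul, electric_eq, mul_sub, Matrix.mul_smul, Matrix.mul_smul, ε_mul_h, two_smul]
  nth_rewrite 2 [hanti]
  abel

lemma covD2_apply (T : Matrix (Fin 3) (Fin 3) 𝒜) (A B C : Fin 3) :
    S.covD2 T A B C = (S.h * T.map (S.δ C) * S.h) A B := by
  simp only [covD2, Matrix.mul_apply, Finset.sum_mul, Matrix.map_apply]
  rw [Finset.sum_comm]
  exact Finset.sum_congr rfl fun b _ => Finset.sum_congr rfl fun a _ => by
    rw [S.h_isSymm.apply b B]; ring

variable {S} in
lemma trace_h_mul_map_δ {W : Matrix (Fin 3) (Fin 3) 𝒜} (hr : W *ᵥ S.x = 0) (hl : S.x ᵥ* W = 0)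
    (D : Fin 3) : (S.h * W.map (S.δ D)).trace = S.δ D W.trace := by
  have hrow : W.map (S.δ D) *ᵥ S.x = -fun A => W A D := by
    ext A
    have hWA : S.x ⬝ᵥ W A = 0 := by rw [dotProduct_comm]; exact congrFun hr A
    rw [Matrix.mulVec, dotProduct_comm]
    exact congrFun (x_vecMul_jac hWA) D
  have hcol : (S.x ⬝ᵥ fun A => W A D) = 0 := congrFun hl D
  rw [h_eq_sub, sub_mul, one_mul, Matrix.trace_sub, Matrix.trace_mul_comm (Matrix.vecMulVec _ _),
    Matrix.mul_vecMulVec, Matrix.trace_vecMulVec, hrow, neg_dotProduct, dotProduct_comm, hcol,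
    neg_zero, sub_zero, Matrix.trace, Matrix.trace, map_sum]
  rfl

lemma div2_eq (T : Matrix (Fin 3) (Fin 3) 𝒜) : S.div2 T = S.h *ᵥ fun A => S.div1 (T A) := by
  have hh (b : Fin 3) (f : 𝒜) : ∑ B, S.h B b * S.δ B f = S.δ b f := by
    simpa [Matrix.mulVec, dotProduct, S.h_isSymm.apply] using
      congrFun (h_mulVec (S.x_dotProduct_grad f)) b
  ext A
  change ∑ B, ∑ a, ∑ b, S.h A a * S.h B b * S.δ B (T a b) = ∑ a, S.h A a * S.div1 (T a)
  rw [Finset.sum_comm]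
  refine Finset.sum_congr rfl fun a _ => ?_
  rw [Finset.sum_comm, div1_eq_sum, Finset.mul_sum]
  refine Finset.sum_congr rfl fun b _ => ?_
  rw [← hh b, Finset.mul_sum]
  exact Finset.sum_congr rfl fun B _ => mul_assoc _ _ _

variable {S} in
lemma IsSTF.div2_eq {T : Matrix (Fin 3) (Fin 3) 𝒜} (hT : S.IsSTF T) :
    S.div2 T = fun A => S.div1 (T A) := by
  refine (S.div2_eq T).trans (h_mulVec ?_)
  have hrow (B) : ∑ A, S.x A * S.δ B (T A B) = -T B B := by
    simp_rw [fun A => hT.isSymm.apply B A]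
    refine congrFun (x_vecMul_jac (v := T B) ?_) B
    rw [dotProduct_comm]
    exact congrFun hT.mulVec_x B
  simp only [dotProduct, div1_eq_sum, Finset.mul_sum]
  rw [Finset.sum_comm, Finset.sum_congr rfl fun B _ => hrow B, Finset.sum_neg_distrib, neg_eq_zero]
  exact hT.trace_eq_zero

lemma div2_smul_h (f : 𝒜) : S.div2 (f • S.h) = S.grad f := by
  have hrow : (fun A => S.div1 ((f • S.h) A)) = S.grad f - (2 * f) • S.x := by
    ext A
    change S.div1 (f • S.h A) = S.δ A f - 2 * f * S.x A
    rw [← grad_x, div1_smul, ← lap_eq_div1_grad, lap_x, dotProduct_comm, grad_dotProduct_grad_x]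
    ring
  rw [div2_eq, hrow, h_mulVec_sub_smul_x (S.x_dotProduct_grad f)]

lemma div2_hess (f : 𝒜) : S.div2 (S.hess f) = S.grad (S.lap f + f) := by
  have hrow : (fun A => S.div1 (S.hess f A)) = S.grad (S.lap f + f) - S.lap f • S.x := by
    ext A
    have hA : S.hess f A = S.grad (S.δ A f) + S.x A • S.grad f := funext (S.hess_apply f A)
    rw [hA, map_add, ← lap_eq_div1_grad, div1_x_smul_grad, lap_δ, map_add]
    simp only [Pi.sub_apply, Pi.add_apply, Pi.smul_apply, grad_apply, smul_eq_mul]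
    ring
  rw [div2_eq, hrow, h_mulVec_sub_smul_x (S.x_dotProduct_grad _)]

lemma div2_electric (c : 𝒜) : S.div2 (S.electric c) = S.grad (S.lapAddTwo c) := by
  rw [electric_eq, map_sub, map_nsmul, div2_smul_h, div2_hess, lapAddTwo_apply, ← map_nsmul,
    ← map_sub]
  congr 1
  module

variable {S} in
lemma div2_ε_mul {T : Matrix (Fin 3) (Fin 3) 𝒜} (hT : S.IsSTF T) :
    S.div2 (S.ε * T) = S.ε *ᵥ S.div2 T := by
  have hsymm10 := hT.isSymm.apply 0 1
  have hsymm20 := hT.isSymm.apply 0 2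
  have hsymm21 := hT.isSymm.apply 1 2
  have hx0 := sum_mul_x hT.mulVec_x 0
  have hx1 := sum_mul_x hT.mulVec_x 1
  have hx2 := sum_mul_x hT.mulVec_x 2
  rw [hT.ε_mul.div2_eq, hT.div2_eq]
  ext A
  simp only [Matrix.mulVec, Matrix.vec3_dotProduct, div1_eq_sum, Fin.sum_univ_three,
    Matrix.mul_apply, map_add, Derivation.leibniz, smul_eq_mul]
  fin_cases A <;> simp [ε, S.δ_x] <;> grind

lemma div2_magnetic (b : 𝒜) : S.div2 (S.magnetic b) = S.curl (S.lapAddTwo b) := by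
  rw [magnetic_eq_ε_mul, div2_ε_mul (S.isSTF_electric b), div2_electric, curl_eq]

lemma sum_covD2_mul_x (T : Matrix (Fin 3) (Fin 3) 𝒜) (A C : Fin 3) :
    ∑ B, S.covD2 T A B C * S.x B = 0 := by
  have hx : (S.h * T.map (S.δ C) * S.h) *ᵥ S.x = 0 := by
    rw [← Matrix.mulVec_mulVec, h_mulVec_x, Matrix.mulVec_zero]
  simp only [covD2_apply]
  exact congrFun hx A

lemma sum_x_mul_covD2 (T : Matrix (Fin 3) (Fin 3) 𝒜) (A B : Fin 3) :
    ∑ C, S.x C * S.covD2 T A B C = 0 := by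
  simp only [covD2, Finset.mul_sum, mul_left_comm (S.x _)]
  rw [Finset.sum_comm]
  refine Finset.sum_eq_zero fun a _ => ?_
  rw [Finset.sum_comm]
  refine Finset.sum_eq_zero fun b _ => ?_
  rw [← Finset.mul_sum]
  exact mul_eq_zero_of_right _ (S.x_dotProduct_δ (T a b))

lemma sum_covD3_covD2 (T : Matrix (Fin 3) (Fin 3) 𝒜) (A D : Fin 3) :
    ∑ B, S.covD3 (S.covD2 T) A B B D = S.covD1 (S.div2 T) A D := by
  have htrace (a : Fin 3) : ∑ b, ∑ c, S.h b c * S.δ D (S.covD2 T a b c) = S.δ D (S.div2 T a) := by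
    let W : Matrix (Fin 3) (Fin 3) 𝒜 := Matrix.of fun c b => S.covD2 T a b c
    have hr : W *ᵥ S.x = 0 := funext fun c => S.sum_covD2_mul_x T a c
    have hl : S.x ᵥ* W = 0 := funext fun b => S.sum_x_mul_covD2 T a b
    exact trace_h_mul_map_δ hr hl D
  have hh (b c : Fin 3) : ∑ B, S.h B b * S.h B c = S.h b c := by
    conv_rhs => rw [← h_mul_h]
    simp only [Matrix.mul_apply, S.h_isSymm.apply b]
  calc ∑ B, S.covD3 (S.covD2 T) A B B D
      = ∑ a, S.h A a * ∑ b, ∑ c, (∑ B, S.h B b * S.h B c) * S.δ D (S.covD2 T a b c) := by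
        simp only [covD3, Finset.mul_sum, Finset.sum_mul]
        rw [Finset.sum_comm]
        refine Finset.sum_congr rfl fun a _ => ?_
        rw [Finset.sum_comm]
        refine Finset.sum_congr rfl fun b _ => ?_
        rw [Finset.sum_comm]
        exact Finset.sum_congr rfl fun c _ => Finset.sum_congr rfl fun B _ => by ring
    _ = ∑ a, S.h A a * S.δ D (S.div2 T a) := by simp only [hh, htrace]

variable {S} in
lemma covD2_comm {T : Matrix (Fin 3) (Fin 3) 𝒜} (hT : T.IsSymm) (A B C : Fin 3) :
    S.covD2 T A B C = S.covD2 T B A C := by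
  rw [covD2, covD2, Finset.sum_comm]
  exact Finset.sum_congr rfl fun b _ => Finset.sum_congr rfl fun a _ => by
    rw [hT.apply b a, mul_comm (S.h A a)]

variable {S} in
lemma covD3_covD2_comm {T : Matrix (Fin 3) (Fin 3) 𝒜} (hT : T.IsSymm) (A B C D : Fin 3) :
    S.covD3 (S.covD2 T) A B C D = S.covD3 (S.covD2 T) B A C D := by
  rw [covD3, covD3, Finset.sum_comm]
  exact Finset.sum_congr rfl fun b _ => Finset.sum_congr rfl fun a _ =>
    Finset.sum_congr rfl fun c _ => by rw [covD2_comm hT a b, mul_comm (S.h A a)]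

lemma sum_ε_mul_covD3_covD2_electric (c : 𝒜) :
    ∑ A, ∑ B, ∑ C, S.ε A C * S.covD3 (S.covD2 (S.electric c)) B A B C = 0 := by
  have hcontract (A C : Fin 3) : ∑ B, S.covD3 (S.covD2 (S.electric c)) B A B C =
      S.hess (S.lapAddTwo c) C A := by
    rw [Finset.sum_congr rfl fun B _ => covD3_covD2_comm (S.isSTF_electric c).isSymm B A B C,
      sum_covD3_covD2, div2_electric, ← hess_eq_covD1_grad, (S.hess_isSymm _).apply]
  calc ∑ A, ∑ B, ∑ C, S.ε A C * S.covD3 (S.covD2 (S.electric c)) B A B C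
      = ∑ A, ∑ C, S.ε A C * ∑ B, S.covD3 (S.covD2 (S.electric c)) B A B C := by
        simp only [Finset.mul_sum]
        exact Finset.sum_congr rfl fun A _ => Finset.sum_comm
    _ = (S.ε * S.hess (S.lapAddTwo c)).trace :=
        Finset.sum_congr rfl fun A _ => Finset.sum_congr rfl fun C _ =>
          congrArg _ (hcontract A C)
    _ = 0 := by rw [Matrix.trace_mul_comm, trace_mul_ε (S.hess_isSymm _)]

lemma sum_covD3_covD2_tensorOfPotentials (c b : 𝒜) :
    ∑ A, ∑ B, S.covD3 (S.covD2 (S.tensorOfPotentials c b)) A B B A = S.lap (S.lapAddTwo c) := by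
  simp only [sum_covD3_covD2]
  change (S.covD1 _).trace = _
  rw [trace_covD1, tensorOfPotentials, map_add, div2_electric, div2_magnetic, map_add, div1_curl,
    add_zero, ← lap_eq_div1_grad]

variable {S} in
lemma div1_mulVec {T : Matrix (Fin 3) (Fin 3) 𝒜} (hT : S.IsSTF T) (v : Fin 3 → 𝒜) :
    S.div1 (T *ᵥ v) = S.div2 T ⬝ᵥ v + (T * S.covD1 v).trace := by
  have hcov : T * S.covD1 v = T * S.jac v := by
    rw [covD1_eq, ← mul_assoc, mul_h hT.mulVec_x]
  rw [hcov, hT.div2_eq]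
  simp only [div1_eq_sum, Matrix.mulVec, dotProduct, map_sum, Derivation.leibniz, smul_eq_mul,
    Finset.sum_add_distrib, Matrix.trace, Matrix.diag_apply, Matrix.mul_apply, jac_apply]
  rw [add_comm, Finset.sum_comm]
  simp only [Finset.sum_mul, mul_comm (v _), hT.isSymm.apply]

variable {S} in
lemma covD1_mulVec {T : Matrix (Fin 3) (Fin 3) 𝒜} (hT : S.IsSTF T) {v : Fin 3 → 𝒜}
    (hv : S.x ⬝ᵥ v = 0) (A B : Fin 3) :
    S.covD1 (T *ᵥ v) A B = ∑ C, S.covD2 T A C B * v C + (T * S.covD1 v) A B := by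
  have hjac : (fun a => S.jac (T *ᵥ v) a B) = T.map (S.δ B) *ᵥ v + T *ᵥ fun a => S.jac v a B := by
    ext a
    simp only [jac_apply, Matrix.mulVec, dotProduct, map_sum, Derivation.leibniz, smul_eq_mul,
      Matrix.map_apply, Pi.add_apply, Finset.sum_add_distrib, mul_comm (v _)]
    exact add_comm _ _
  calc S.covD1 (T *ᵥ v) A B = (S.h *ᵥ fun a => S.jac (T *ᵥ v) a B) A := rfl
    _ = ((S.h * T.map (S.δ B) * S.h) *ᵥ v) A + ((S.h * T) *ᵥ fun a => S.jac v a B) A := by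
        rw [hjac, Matrix.mulVec_add, ← Matrix.mulVec_mulVec v, h_mulVec hv, Matrix.mulVec_mulVec,
          Matrix.mulVec_mulVec, Pi.add_apply]
    _ = ∑ C, S.covD2 T A C B * v C + (T * S.covD1 v) A B := by
        simp only [covD2_apply, covD1_eq, ← mul_assoc, mul_h hT.mulVec_x, hT.h_mul]
        rfl

/-! ### Integration by parts -/

variable {S} in
lemma int_div1 {v : Fin 3 → 𝒜} (hv : S.x ⬝ᵥ v = 0) : S.int (S.div1 v) = 0 := by
  simp only [div1_eq_sum, map_sum, S.int_δ]
  rw [← map_sum, ← Finset.smul_sum]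
  change S.int (2 • (S.x ⬝ᵥ v)) = 0
  rw [hv, smul_zero, map_zero]

variable {S} in
lemma int_mul_dirDeriv {v : Fin 3 → 𝒜} (hv : S.x ⬝ᵥ v = 0) (f g : 𝒜) :
    S.int (f * S.dirDeriv v g) =
      -S.int (g * S.dirDeriv v f) - S.int (f * g * S.div1 v) := by
  have hdiv : S.div1 ((f * g) • v) =
      f * g * S.div1 v + (f * S.dirDeriv v g + g * S.dirDeriv v f) := by
    rw [div1_smul, ← dirDeriv_apply, Derivation.leibniz, smul_eq_mul, smul_eq_mul]
  have hint := int_div1 (S := S) (v := (f * g) • v) (by rw [dotProduct_smul, hv, smul_zero])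
  rw [hdiv, map_add, map_add] at hint
  linarith

lemma int_mul_lap (f g : 𝒜) : S.int (f * S.lap g) = -S.int (S.grad f ⬝ᵥ S.grad g) := by
  have hint := int_div1 (S := S) (v := f • S.grad g)
    (by rw [dotProduct_smul, x_dotProduct_grad, smul_zero])
  rw [div1_smul, map_add, dotProduct_comm] at hint
  rw [lap_eq_div1_grad]
  linarith

lemma int_mul_lap_comm (f g : 𝒜) : S.int (f * S.lap g) = S.int (g * S.lap f) := by
  rw [int_mul_lap, int_mul_lap, dotProduct_comm]

lemma int_lap (f : 𝒜) : S.int (S.lap f) = 0 := int_div1 (S.x_dotProduct_grad f)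

lemma int_x (A : Fin 3) : S.int (S.x A) = 0 := by
  have hint := S.int_δ A 1
  rw [Derivation.map_one_eq_zero, map_zero, mul_one, map_nsmul] at hint
  simpa using hint.symm

/-! ### The `l = 1` harmonics and the rotation fields -/

/-- The linear combination of `l = 1` harmonics with axis `a`. -/
def dipole (a : Fin 3 → ℝ) : 𝒜 := ∑ A, a A • S.x A

/-- The generator `ε_{AB} n^{||B}` of the rotations about the axis `a`, where `n = dipole a`. -/
def rot (a : Fin 3 → ℝ) : Fin 3 → 𝒜 := S.curl (S.dipole a)

/-- The derivative along the rotation field `rot a`. -/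
def rotDeriv (a : Fin 3 → ℝ) : Derivation ℝ 𝒜 𝒜 := S.dirDeriv (S.rot a)

/-- The derivative along the conformal Killing field `n^{||A}`, where `n = dipole a`. -/
def boostDeriv (a : Fin 3 → ℝ) : Derivation ℝ 𝒜 𝒜 := S.dirDeriv (S.grad (S.dipole a))

variable (a : Fin 3 → ℝ)

lemma rotDeriv_apply (f : 𝒜) : S.rotDeriv a f = S.rot a ⬝ᵥ S.grad f := S.dirDeriv_apply _ f

lemma boostDeriv_apply (f : 𝒜) : S.boostDeriv a f = S.grad (S.dipole a) ⬝ᵥ S.grad f :=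
  S.dirDeriv_apply _ f

lemma lap_dipole : S.lap (S.dipole a) = -(2 * S.dipole a) := by
  simp only [dipole, map_sum, map_smul, lap_x, Finset.mul_sum, mul_smul_comm, smul_neg,
    Finset.sum_neg_distrib]

lemma hess_dipole : S.hess (S.dipole a) = -(S.dipole a • S.h) := by
  have hx (C : Fin 3) : S.hess (S.x C) = -(S.x C • S.h) := by
    ext A B
    rw [hess_apply, ← S.grad_apply (S.x C) A, grad_x]
    simp [h, S.δ_x, apply_ite (S.δ B), eq_comm (a := C)]
  simp only [dipole, map_sum, map_smul, hx, smul_neg, Finset.sum_smul, smul_assoc,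
    Finset.sum_neg_distrib]

lemma covD1_rot : S.covD1 (S.rot a) = -(S.dipole a • S.ε) := by
  rw [rot, covD1_curl, hess_dipole, mul_neg, Matrix.mul_smul, ε_mul_h]

lemma x_dotProduct_rot : S.x ⬝ᵥ S.rot a = 0 := S.x_dotProduct_curl _

lemma int_mul_rotDeriv (f g : 𝒜) :
    S.int (f * S.rotDeriv a g) = -S.int (g * S.rotDeriv a f) := by
  rw [rotDeriv, int_mul_dirDeriv (S.x_dotProduct_rot a), rot, div1_curl, mul_zero, map_zero,
    sub_zero]

lemma int_mul_boostDeriv (f g : 𝒜) : S.int (f * S.boostDeriv a g) =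
    -S.int (g * S.boostDeriv a f) + 2 * S.int (S.dipole a * f * g) := by
  rw [boostDeriv, int_mul_dirDeriv (S.x_dotProduct_grad _), ← lap_eq_div1_grad, lap_dipole,
    show f * g * -(2 * S.dipole a) = (-2 : ℝ) • (S.dipole a * f * g) by
      rw [neg_smul, ofNat_smul_eq_nsmul, nsmul_eq_mul]; push_cast; ring,
    map_smul, smul_eq_mul]
  ring

lemma boostDeriv_eq_sum (f : 𝒜) : S.boostDeriv a f = ∑ A, a A • S.δ A f := by
  simp only [boostDeriv_apply, dipole, map_sum, map_smul, sum_dotProduct, smul_dotProduct,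
    dotProduct_comm (S.grad (S.x _)), grad_dotProduct_grad_x]

lemma lap_boostDeriv (f : 𝒜) :
    S.lap (S.boostDeriv a f) = S.boostDeriv a (S.lap f) - 2 * (S.dipole a * S.lap f) := by
  simp only [boostDeriv_eq_sum, map_sum, map_smul, lap_δ, smul_sub, Finset.sum_sub_distrib,
    dipole, Finset.sum_mul, Finset.mul_sum, smul_mul_assoc, mul_smul_comm]

lemma lap_dipole_mul (f : 𝒜) : S.lap (S.dipole a * f) =
    S.dipole a * S.lap f - 2 * (S.dipole a * f) + 2 * S.boostDeriv a f := by
  rw [lap_mul, lap_dipole, boostDeriv_apply]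
  ring

lemma lap_x_mul_δ_sub (A B : Fin 3) (f : 𝒜) :
    S.lap (S.x A * S.δ B f - S.x B * S.δ A f) =
      S.x A * S.δ B (S.lap f) - S.x B * S.δ A (S.lap f) := by
  simp only [map_sub, lap_mul, lap_x, lap_δ, dotProduct_comm (S.grad (S.x _)),
    grad_dotProduct_grad_x]
  rw [S.δ_comm A B]
  ring

lemma rotDeriv_eq (f : 𝒜) : S.rotDeriv a f =
    a 0 • (S.x 1 * S.δ 2 f - S.x 2 * S.δ 1 f) + a 1 • (S.x 2 * S.δ 0 f - S.x 0 * S.δ 2 f) +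
      a 2 • (S.x 0 * S.δ 1 f - S.x 1 * S.δ 0 f) := by
  have hrot : S.rot a = S.ε *ᵥ fun A => algebraMap ℝ 𝒜 (a A) := by
    have hgrad : S.grad (S.dipole a) = S.h *ᵥ fun A => algebraMap ℝ 𝒜 (a A) := by
      ext A
      simp only [dipole, map_sum, map_smul, grad_x, Finset.sum_apply, Pi.smul_apply,
        Matrix.mulVec, dotProduct]
      exact Finset.sum_congr rfl fun B _ => by
        rw [Algebra.smul_def, S.h_isSymm.apply, mul_comm]
    rw [rot, curl_eq, hgrad, Matrix.mulVec_mulVec, ε_mul_h]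
  rw [rotDeriv_apply, hrot]
  simp only [Matrix.mulVec, Matrix.vec3_dotProduct, grad_apply, Algebra.smul_def]
  simp [ε]
  ring

lemma lap_rotDeriv (f : 𝒜) : S.lap (S.rotDeriv a f) = S.rotDeriv a (S.lap f) := by
  simp only [rotDeriv_eq, map_add, map_smul, lap_x_mul_δ_sub]

lemma curl_dotProduct_rot (f : 𝒜) : S.curl f ⬝ᵥ S.rot a = S.boostDeriv a f := by
  rw [rot, curl_eq, ε_mulVec_dotProduct, curl_eq, Matrix.mulVec_mulVec, ε_mul_ε,
    Matrix.neg_mulVec, h_mulVec (S.x_dotProduct_grad _), dotProduct_neg, neg_neg, dotProduct_comm,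
    boostDeriv_apply]

/-! ### Symmetric traceless tensors contracted with a rotation field -/

variable {S}

lemma IsSTF.mul_ε {T : Matrix (Fin 3) (Fin 3) 𝒜} (hT : S.IsSTF T) : T * S.ε = -(S.ε * T) := by
  have h_symm := hT.ε_mul.isSymm
  rw [Matrix.IsSymm, Matrix.transpose_mul, hT.isSymm, ε_transpose, mul_neg] at h_symm
  rw [← h_symm, neg_neg]

lemma IsSTF.x_dotProduct_mulVec {T : Matrix (Fin 3) (Fin 3) 𝒜} (hT : S.IsSTF T)
    (v : Fin 3 → 𝒜) : S.x ⬝ᵥ T *ᵥ v = 0 := by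
  rw [dotProduct_comm, mulVec_dotProduct_comm hT.isSymm, hT.mulVec_x, zero_dotProduct]

lemma IsSTF.div1_mulVec_rot {T : Matrix (Fin 3) (Fin 3) 𝒜} (hT : S.IsSTF T) :
    S.div1 (T *ᵥ S.rot a) = S.div2 T ⬝ᵥ S.rot a := by
  rw [div1_mulVec hT, covD1_rot, mul_neg, Matrix.mul_smul, Matrix.trace_neg, Matrix.trace_smul,
    trace_mul_ε hT.isSymm, smul_zero, neg_zero, add_zero]

lemma IsSTF.int_mulVec_grad_dotProduct_rot {T : Matrix (Fin 3) (Fin 3) 𝒜} (hT : S.IsSTF T)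
    (g : 𝒜) : S.int (T *ᵥ S.grad g ⬝ᵥ S.rot a) = -S.int (g * (S.div2 T ⬝ᵥ S.rot a)) := by
  have hint := int_div1 (S := S) (v := g • T *ᵥ S.rot a)
    (by rw [dotProduct_smul, hT.x_dotProduct_mulVec, smul_zero])
  rw [div1_smul, hT.div1_mulVec_rot, map_add] at hint
  rw [mulVec_dotProduct_comm hT.isSymm]
  linarith

variable (S)

lemma int_electric_mulVec_grad_dotProduct_rot (f g : 𝒜) :
    S.int (S.electric f *ᵥ S.grad g ⬝ᵥ S.rot a) =
      -S.int (g * S.rotDeriv a (S.lapAddTwo f)) := by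
  rw [(S.isSTF_electric f).int_mulVec_grad_dotProduct_rot, div2_electric, dotProduct_comm,
    rotDeriv_apply]

lemma int_magnetic_mulVec_grad_dotProduct_rot (f g : 𝒜) :
    S.int (S.magnetic f *ᵥ S.grad g ⬝ᵥ S.rot a) =
      -S.int (g * S.boostDeriv a (S.lapAddTwo f)) := by
  rw [(S.isSTF_magnetic f).int_mulVec_grad_dotProduct_rot, div2_magnetic, curl_dotProduct_rot]

lemma electric_mulVec_curl (f g : 𝒜) :
    S.electric f *ᵥ S.curl g = -(S.magnetic f *ᵥ S.grad g) := by
  rw [curl_eq, Matrix.mulVec_mulVec, (S.isSTF_electric f).mul_ε, magnetic_eq_ε_mul,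
    Matrix.neg_mulVec]

/-! ### The effect of a supertranslation -/

/-- `8π` times the angular momentum about the axis `a` of data with mass aspect `μ`, angular
aspect `ν` and shear `T`, where `c` is the potential in the correction term. -/
def charge (μ : 𝒜) (ν : Fin 3 → 𝒜) (T : Matrix (Fin 3) (Fin 3) 𝒜) (c : 𝒜) : ℝ :=
  -(3 * S.int (ν ⬝ᵥ S.rot a) + 1 / 4 * S.int (T *ᵥ S.div2 T ⬝ᵥ S.rot a)) +
    3 * S.int (μ * S.rotDeriv a c)

/-- The angular aspect after the supertranslation by `f` of data with mass aspect `μ`, angular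
aspect `ν` and stationary shear `T`. -/
def supertranslatedAspect (f μ : 𝒜) (ν : Fin 3 → 𝒜) (T : Matrix (Fin 3) (Fin 3) 𝒜) :
    Fin 3 → 𝒜 :=
  ν - μ • S.grad f + (1 / 4 : ℝ) • (S.covD1 (S.div2 T) - (S.covD1 (S.div2 T))ᵀ) *ᵥ S.grad f

lemma int_boostDeriv_mul_lap (f g : 𝒜) :
    3 * S.int (S.boostDeriv a f * S.lap g) + S.int (S.lapAddTwo f * S.boostDeriv a g) -
        S.int (g * S.boostDeriv a (S.lapAddTwo f)) =
      -S.int (f * S.boostDeriv a (S.lap g)) := by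
  have hlap_f : S.int (f * S.boostDeriv a (S.lap g)) =
      -S.int (S.boostDeriv a f * S.lap g) + 2 * S.int (S.dipole a * f * S.lap g) := by
    rw [int_mul_boostDeriv, mul_comm (S.lap g)]
  have hlapAddTwo_f := S.int_mul_boostDeriv a (S.lapAddTwo f) g
  have hboost := S.int_mul_lap_comm (S.boostDeriv a f) g
  have hdipole := S.int_mul_lap_comm (S.dipole a * f) g
  rw [lap_boostDeriv] at hboost
  rw [lap_dipole_mul] at hdipole
  rw [hlap_f, hlapAddTwo_f, hboost, hdipole, mul_comm (S.dipole a * S.lapAddTwo f)]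
  simp only [lapAddTwo_apply, two_smul, two_mul, map_add, mul_add, mul_sub, map_sub]
  linarith

lemma covD1_div2_sub_transpose (c b : 𝒜) :
    S.covD1 (S.div2 (S.tensorOfPotentials c b)) -
        (S.covD1 (S.div2 (S.tensorOfPotentials c b)))ᵀ =
      S.lap (S.lapAddTwo b) • S.ε := by
  rw [tensorOfPotentials, map_add, div2_electric, div2_magnetic, map_add, ← hess_eq_covD1_grad,
    covD1_curl, Matrix.transpose_add, S.hess_isSymm, add_sub_add_left_eq_sub,
    ε_mul_sub_transpose (S.hess_isSymm _) (S.hess_mulVec_x _), trace_hess]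

lemma int_mulVec_div2_dotProduct_rot (c b : 𝒜) :
    S.int (S.tensorOfPotentials c b *ᵥ S.div2 (S.tensorOfPotentials c b) ⬝ᵥ S.rot a) =
      S.int (S.lapAddTwo b * S.boostDeriv a (S.lapAddTwo c)) -
        S.int (S.lapAddTwo c * S.boostDeriv a (S.lapAddTwo b)) +
      S.int (S.magnetic b *ᵥ S.curl (S.lapAddTwo b) ⬝ᵥ S.rot a) := by
  have helectric : S.int (S.electric c *ᵥ S.grad (S.lapAddTwo c) ⬝ᵥ S.rot a) = 0 := by
    have hanti := S.int_mul_rotDeriv a (S.lapAddTwo c) (S.lapAddTwo c)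
    rw [int_electric_mulVec_grad_dotProduct_rot]
    linarith
  rw [tensorOfPotentials, map_add S.div2, div2_electric, div2_magnetic, Matrix.add_mulVec,
    Matrix.mulVec_add, Matrix.mulVec_add, electric_mulVec_curl]
  simp only [add_dotProduct, neg_dotProduct, map_add, map_neg, helectric,
    int_magnetic_mulVec_grad_dotProduct_rot]
  ring

lemma charge_supertranslated (f μ c b : 𝒜) (ν : Fin 3 → 𝒜) :
    S.charge a μ (S.supertranslatedAspect f μ ν (S.tensorOfPotentials c b))
        (S.tensorOfPotentials (c - f) b) (c - f) =
      S.charge a μ ν (S.tensorOfPotentials c b) c +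
        1 / 4 * S.int (f * S.boostDeriv a (S.lap (S.lapAddTwo b))) := by
  have hstatic := S.int_boostDeriv_mul_lap a f (S.lapAddTwo b)
  rw [charge, charge, supertranslatedAspect, covD1_div2_sub_transpose, Matrix.smul_mulVec,
    ← curl_eq, int_mulVec_div2_dotProduct_rot, int_mulVec_div2_dotProduct_rot]
  simp only [add_dotProduct, sub_dotProduct, smul_dotProduct, curl_dotProduct_rot, smul_eq_mul,
    dotProduct_comm (S.grad f), ← rotDeriv_apply, map_add, map_sub, map_smul, mul_sub, sub_mul,
    mul_comm (S.lap (S.lapAddTwo b))]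
  linarith

/-! ### The flux of angular momentum for a purely electric shear -/

lemma trace_electric_mul_self (c : 𝒜) : (S.electric c * S.electric c).trace =
    (4 : ℝ) • (S.hess c * S.hess c).trace - (2 : ℝ) • (S.lap c * S.lap c) := by
  simp only [electric_eq, sub_mul, mul_sub, Matrix.trace_sub, Matrix.trace_smul, smul_mul_assoc,
    mul_smul_comm, mul_h (S.hess_mulVec_x c), h_mul_h]
  rw [Matrix.trace_mul_comm S.h, mul_h (S.hess_mulVec_x c), trace_hess, trace_h]
  simp only [smul_eq_mul, ofNat_smul_eq_nsmul, nsmul_eq_mul]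
  push_cast
  ring

lemma int_dipole_mul_curl_dotProduct_grad (f g : 𝒜) :
    S.int (S.dipole a * (S.curl f ⬝ᵥ S.grad g)) = S.int (g * S.rotDeriv a f) := by
  have hint := int_div1 (S := S) (v := (S.dipole a * g) • S.curl f)
    (by rw [dotProduct_smul, x_dotProduct_curl, smul_zero])
  have hrot : S.curl f ⬝ᵥ S.grad (S.dipole a) = -S.rotDeriv a f := by
    rw [curl_eq, ε_mulVec_dotProduct, ← curl_eq, dotProduct_comm, rotDeriv_apply, rot]
  rw [div1_smul, div1_curl, mul_zero, zero_add, grad_mul, dotProduct_add, dotProduct_smul,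
    dotProduct_smul, hrot, smul_eq_mul, smul_eq_mul, mul_neg, map_add, map_neg] at hint
  linarith

lemma int_dipole_mul_trace_magnetic_mul_electric (e c : 𝒜) :
    S.int (S.dipole a * (S.magnetic e * S.electric c).trace) =
      4 * S.int (S.lapAddTwo e * S.rotDeriv a c) := by
  have hmag := S.isSTF_magnetic e
  have htrace : (S.magnetic e * S.electric c).trace = 2 • (S.magnetic e * S.hess c).trace := by
    rw [electric_eq, mul_sub, Matrix.mul_smul, Matrix.mul_smul, mul_h hmag.mulVec_x,
      Matrix.trace_sub, Matrix.trace_smul, Matrix.trace_smul, hmag.trace_eq_zero, smul_zero,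
      sub_zero]
  have hgrad : S.magnetic e *ᵥ S.grad c ⬝ᵥ S.grad (S.dipole a) =
      -(S.electric e *ᵥ S.grad c ⬝ᵥ S.rot a) := by
    rw [mulVec_dotProduct_comm hmag.isSymm, mulVec_dotProduct_comm (S.isSTF_electric e).isSymm, rot,
      electric_mulVec_curl, neg_dotProduct, neg_neg]
  have hint := int_div1 (S := S) (v := S.dipole a • S.magnetic e *ᵥ S.grad c)
    (by rw [dotProduct_smul, hmag.x_dotProduct_mulVec, smul_zero])
  rw [div1_smul, div1_mulVec hmag, div2_magnetic, ← hess_eq_covD1_grad, hgrad, mul_add, map_add,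
    map_add, map_neg, int_dipole_mul_curl_dotProduct_grad,
    int_electric_mulVec_grad_dotProduct_rot] at hint
  rw [htrace, mul_smul_comm, map_nsmul, int_mul_rotDeriv, nsmul_eq_mul]
  push_cast
  linarith

lemma trace_mul_covD1_mulVec_rot {T W : Matrix (Fin 3) (Fin 3) 𝒜} (hT : S.IsSTF T)
    (hW : S.IsSTF W) : (T * S.covD1 (W *ᵥ S.rot a)).trace =
      (fun A => ∑ C, ∑ D, T C D * S.covD2 W A C D) ⬝ᵥ S.rot a -
        S.dipole a * (S.ε * T * W).trace := by
  have hcov : (T * S.covD1 (W *ᵥ S.rot a)).trace =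
      ∑ A, ∑ B, T A B * ∑ C, S.covD2 W B C A * S.rot a C +
        (T * (W * S.covD1 (S.rot a))).trace := by
    simp only [Matrix.trace, Matrix.diag_apply, Matrix.mul_apply (M := T),
      covD1_mulVec hW (S.x_dotProduct_rot a), mul_add, Finset.sum_add_distrib]
  have hswap : ∑ A, ∑ B, T A B * ∑ C, S.covD2 W B C A * S.rot a C =
      (fun A => ∑ C, ∑ D, T C D * S.covD2 W A C D) ⬝ᵥ S.rot a := by
    simp only [dotProduct, Finset.mul_sum, Finset.sum_mul]
    rw [Finset.sum_congr rfl fun A _ => Finset.sum_comm, Finset.sum_comm]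
    refine Finset.sum_congr rfl fun C _ => ?_
    rw [Finset.sum_comm]
    exact Finset.sum_congr rfl fun B _ => Finset.sum_congr rfl fun A _ => by
      rw [hT.isSymm.apply, covD2_comm hW.isSymm B, mul_assoc]
  rw [hcov, hswap, covD1_rot, ← mul_assoc, mul_neg, Matrix.mul_smul, Matrix.trace_neg,
    Matrix.trace_smul, Matrix.trace_mul_comm _ S.ε, ← mul_assoc, smul_eq_mul, sub_eq_add_neg]

lemma int_quadratic_flux (e c : 𝒜) :
    S.int (S.electric c *ᵥ S.grad (S.lapAddTwo e) ⬝ᵥ S.rot a) +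
        S.int ((fun A => ∑ C, ∑ D, S.electric e C D * S.covD2 (S.electric c) A C D) ⬝ᵥ S.rot a) =
      4 * S.int (S.lapAddTwo e * S.rotDeriv a c) := by
  have he := S.isSTF_electric e
  have hc := S.isSTF_electric c
  have hint := int_div1 (he.x_dotProduct_mulVec (S.electric c *ᵥ S.rot a))
  rw [div1_mulVec he, div2_electric, trace_mul_covD1_mulVec_rot S a he hc, ← magnetic_eq_ε_mul,
    dotProduct_comm, ← mulVec_dotProduct_comm hc.isSymm, map_add, map_sub,
    int_dipole_mul_trace_magnetic_mul_electric] at hint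
  linarith

lemma int_rotDeriv (f : 𝒜) : S.int (S.rotDeriv a f) = 0 := by
  have hparts := S.int_mul_rotDeriv a 1 f
  rwa [Derivation.map_one_eq_zero, mul_zero, map_zero, neg_zero, one_mul] at hparts

lemma int_lapAddTwo_mul_rotDeriv (f g : 𝒜) :
    S.int (S.lapAddTwo f * S.rotDeriv a g) = S.int (f * S.rotDeriv a (S.lapAddTwo g)) := by
  simp only [lapAddTwo_apply, map_add, map_nsmul, add_mul, mul_add, smul_mul_assoc, mul_smul_comm]
  rw [mul_comm (S.lap f), int_mul_lap_comm, lap_rotDeriv]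

/-- The rate of change of the mass aspect when the shear is `electric c` and `e` is the rate of
change of `c`. -/
def massRate (e : 𝒜) : 𝒜 :=
  -(1 / 8 : ℝ) • (S.electric e * S.electric e).trace + (1 / 4 : ℝ) • S.lap (S.lapAddTwo e)

/-- The rate of change of `3 N_A + ¼ χ_{AB} χ^{BC}_{||C}` when the mass aspect is `μ`, the shear is
`electric c` and `e` is the rate of change of `c`. -/
def angularRate (μ c e : 𝒜) : Fin 3 → 𝒜 :=
  -S.grad μ - (1 / 2 : ℝ) • S.electric c *ᵥ S.grad (S.lapAddTwo e) -
    (1 / 4 : ℝ) • (fun A => ∑ C, ∑ D, S.electric e C D * S.covD2 (S.electric c) A C D) +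
    (1 / 4 : ℝ) • S.electric e *ᵥ S.grad (S.lapAddTwo c)

lemma int_angular_flux (μ c e : 𝒜) :
    -S.int (S.angularRate μ c e ⬝ᵥ S.rot a) +
        3 * (S.int (S.massRate e * S.rotDeriv a c) + S.int (μ * S.rotDeriv a e)) =
      S.int ((3 : ℝ) • (μ * S.rotDeriv a e) -
        (3 / 2 : ℝ) • (S.rotDeriv a c * (S.hess e * S.hess e).trace) +
        (3 / 4 : ℝ) • (S.rotDeriv a c * (S.lap e * S.lap e)) +
        (1 / 4 : ℝ) • (S.rotDeriv a c * S.lap (S.lapAddTwo e))) := by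
  have hflux := S.int_quadratic_flux a e c
  have hμ := S.int_rotDeriv a μ
  have hcomm : S.int (S.rotDeriv a c * S.lap (S.lapAddTwo e)) +
      2 * S.int (S.lapAddTwo e * S.rotDeriv a c) =
      -S.int (S.lapAddTwo c * S.rotDeriv a (S.lapAddTwo e)) := by
    rw [← int_mul_rotDeriv, ← int_lapAddTwo_mul_rotDeriv, S.lapAddTwo_apply (S.lapAddTwo e),
      add_mul, smul_mul_assoc, map_add, map_nsmul, nsmul_eq_mul, mul_comm (S.lap _)]
    norm_num
  have hanti := S.int_mul_rotDeriv a (S.lapAddTwo e) (S.lapAddTwo c)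
  rw [int_electric_mulVec_grad_dotProduct_rot] at hflux
  simp only [massRate, angularRate, add_dotProduct, sub_dotProduct, smul_dotProduct,
    neg_dotProduct, dotProduct_comm (S.grad μ), ← rotDeriv_apply, trace_electric_mul_self, smul_sub,
    mul_add, mul_sub, mul_smul_comm, map_add, map_sub, map_neg, map_smul, smul_eq_mul, hμ,
    int_electric_mulVec_grad_dotProduct_rot, mul_comm _ (S.rotDeriv a c)]
  linarith

end SphereCalculus

open Filter MeasureTheory Topology

/-! ### Smooth functions on the sphere and their radial extensions -/

instance fact_finrank_E3 : Fact (Module.finrank ℝ E3 = 2 + 1) := ⟨by simp⟩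

open Classical in
/-- The radial projection `y ↦ y / ‖y‖` onto the sphere, with an arbitrary value at the origin. -/
def radialProj (y : E3) : S2 :=
  if hy : y ≠ 0 then ⟨‖y‖⁻¹ • y, normalize_mem hy⟩ else ⟨EuclideanSpace.single 0 1, by simp⟩

lemma coe_radialProj {y : E3} (hy : y ≠ 0) : (radialProj y : E3) = ‖y‖⁻¹ • y := by
  simp [radialProj, hy]

lemma radialProj_coe (x : S2) : radialProj x = x := by
  ext1
  simp [coe_radialProj (ne_zero_of_mem_unit_sphere x)]

lemma radialProj_smul {s : ℝ} (hs : 0 < s) {y : E3} (hy : y ≠ 0) :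
    radialProj (s • y) = radialProj y := by
  ext1
  rw [coe_radialProj hy, coe_radialProj (smul_ne_zero hs.ne' hy), norm_smul, Real.norm_of_nonneg
    hs.le, smul_smul, mul_inv, mul_right_comm, inv_mul_cancel₀ hs.ne', one_mul]

lemma radialExt_apply (F : S2 → ℝ) {y : E3} (hy : y ≠ 0) : radialExt F y = F (radialProj y) := by
  simp [radialExt, radialProj, hy]

lemma radialExt_eventuallyEq (F : S2 → ℝ) {y : E3} (hy : y ≠ 0) :
    radialExt F =ᶠ[𝓝 y] fun z => F (radialProj z) :=
  (eventually_ne_nhds hy).mono fun _ hz => radialExt_apply F hz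

lemma radialExt_coe (F : S2 → ℝ) (x : S2) : radialExt F x = F x := by
  rw [radialExt_apply F (ne_zero_of_mem_unit_sphere x), radialProj_coe]

lemma radialExt_add (f g : S2 → ℝ) : radialExt (f + g) = radialExt f + radialExt g := by
  funext y
  by_cases hy : y = 0 <;> simp [radialExt, hy]

lemma radialExt_mul (f g : S2 → ℝ) : radialExt (f * g) = radialExt f * radialExt g := by
  funext y
  by_cases hy : y = 0 <;> simp [radialExt, hy]

lemma radialExt_smul (f : S2 → ℝ) {s : ℝ} (hs : 0 < s) (y : E3) :
    radialExt f (s • y) = radialExt f y := by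
  by_cases hy : y = 0
  · simp [hy]
  · rw [radialExt_apply f hy, radialExt_apply f (smul_ne_zero hs.ne' hy), radialProj_smul hs hy]

lemma contMDiffAt_radialProj {y : E3} (hy : y ≠ 0) :
    ContMDiffAt 𝓘(ℝ, E3) (𝓡 2) ∞ radialProj y := by
  let U : TopologicalSpace.Opens E3 := ⟨{0}ᶜ, isOpen_compl_singleton⟩
  have normalize_contMDiff :
      ContMDiff 𝓘(ℝ, E3) 𝓘(ℝ, E3) ∞ (fun z : U => ‖(z : E3)‖⁻¹ • (z : E3)) := fun z =>
    contMDiffAt_subtype_iff (f := fun w : E3 => ‖w‖⁻¹ • w).2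
      (((contDiffAt_norm ℝ z.2).inv (norm_ne_zero_iff.2 z.2)).smul contDiffAt_id).contMDiffAt
  refine (contMDiffAt_subtype_iff (U := U) (f := radialProj) (x := ⟨y, hy⟩)).1 <|
    (normalize_contMDiff.codRestrict_sphere (n := 2)
      (fun z => normalize_mem z.2) ⟨y, hy⟩).congr_of_eventuallyEq <|
    Eventually.of_forall fun z => ?_
  ext1
  exact coe_radialProj z.2

/-- The extension of a time-dependent function on the sphere which is constant along rays. -/
def timeExt (F : ℝ → S2 → ℝ) (p : ℝ × E3) : ℝ := radialExt (F p.1) p.2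

lemma smooth_const (a : ℝ) : Smooth (fun _ => a) := contMDiff_const

lemma smooth_coord (A : Fin 3) : Smooth (fun x => (x : E3) A) :=
  (EuclideanSpace.proj (𝕜 := ℝ) A).contDiff.contMDiff.comp (contMDiff_coe_sphere (n := 2))

section SmoothOn

variable {I : Set ℝ} {F G : ℝ → S2 → ℝ}

lemma SmoothOn.contDiffOn (hF : SmoothOn I F) : ContDiffOn ℝ ∞ (timeExt F) (I ×ˢ {0}ᶜ) := by
  rw [← contMDiffOn_iff_contDiffOn, modelWithCornersSelf_prod, ← chartedSpaceSelf_prod]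
  have hproj : ContMDiffOn (𝓘(ℝ, ℝ).prod 𝓘(ℝ, E3)) (𝓘(ℝ, ℝ).prod (𝓡 2)) ∞
      (fun p : ℝ × E3 => (p.1, radialProj p.2)) (I ×ˢ {0}ᶜ) :=
    contMDiffOn_fst.prodMk fun p hp =>
      ((contMDiffAt_radialProj hp.2).comp p contMDiffAt_snd).contMDiffWithinAt
  exact (ContMDiffOn.comp hF hproj fun p hp => ⟨hp.1, trivial⟩).congr
    fun p hp => radialExt_apply _ hp.2

lemma SmoothOn.of_contDiffOn {H : ℝ × E3 → ℝ} (hH : ContDiffOn ℝ ∞ H (I ×ˢ {0}ᶜ)) :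
    SmoothOn I (fun u x => H (u, x)) := by
  have hcoe : ContMDiffOn (𝓘(ℝ, ℝ).prod (𝓡 2)) 𝓘(ℝ, ℝ × E3) ∞
      (fun p : ℝ × S2 => (p.1, (p.2 : E3))) (I ×ˢ Set.univ) :=
    contMDiffOn_fst.prodMk_space (contMDiff_coe_sphere.comp_contMDiffOn contMDiffOn_snd)
  exact hH.contMDiffOn.comp hcoe fun p hp => ⟨hp.1, ne_zero_of_mem_unit_sphere p.2⟩

lemma SmoothOn.congr (hF : SmoothOn I F) (h : ∀ u ∈ I, ∀ x, G u x = F u x) : SmoothOn I G :=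
  ContMDiffOn.congr hF fun p hp => h p.1 hp.1 p.2

lemma SmoothOn.add (hF : SmoothOn I F) (hG : SmoothOn I G) :
    SmoothOn I (fun u x => F u x + G u x) := ContMDiffOn.add hF hG

lemma SmoothOn.mul (hF : SmoothOn I F) (hG : SmoothOn I G) :
    SmoothOn I (fun u x => F u x * G u x) := ContMDiffOn.mul hF hG

lemma SmoothOn.sum {ι : Type*} {s : Finset ι} {F : ι → ℝ → S2 → ℝ}
    (hF : ∀ i ∈ s, SmoothOn I (F i)) : SmoothOn I (fun u x => ∑ i ∈ s, F i u x) :=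
  contMDiffOn_finsetSum hF

lemma Smooth.smoothOn {f : S2 → ℝ} (hf : Smooth f) : SmoothOn I (fun _ => f) :=
  (ContMDiff.comp hf contMDiff_snd).contMDiffOn

lemma SmoothOn.const_mul (a : ℝ) (hF : SmoothOn I F) : SmoothOn I (fun u x => a * F u x) :=
  (smooth_const a).smoothOn.mul hF

lemma SmoothOn.smooth (hF : SmoothOn I F) {u : ℝ} (hu : u ∈ I) : Smooth (F u) :=
  ContMDiffOn.comp_contMDiff (t := I ×ˢ Set.univ) (g := fun p : ℝ × S2 => F p.1 p.2) hF
    (contMDiff_const.prodMk contMDiff_id) fun _ => ⟨hu, trivial⟩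

lemma SmoothOn.contDiffAt (hI : IsOpen I) (hF : SmoothOn I F) {u : ℝ} (hu : u ∈ I) {y : E3}
    (hy : y ≠ 0) : ContDiffAt ℝ ∞ (timeExt F) (u, y) :=
  hF.contDiffOn.contDiffAt ((hI.prod isOpen_compl_singleton).mem_nhds ⟨hu, hy⟩)

lemma SmoothOn.hasFDerivAt_timeExt (hI : IsOpen I) (hF : SmoothOn I F) {u : ℝ} (hu : u ∈ I)
    {y : E3} (hy : y ≠ 0) :
    HasFDerivAt (timeExt F) (fderiv ℝ (timeExt F) (u, y)) (u, y) :=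
  ((hF.contDiffAt hI hu hy).differentiableAt (by simp)).hasFDerivAt

lemma SmoothOn.deriv_radialExt (hI : IsOpen I) (hF : SmoothOn I F) {u : ℝ} (hu : u ∈ I) {y : E3}
    (hy : y ≠ 0) :
    radialExt (fun x => deriv (fun s => F s x) u) y = fderiv ℝ (timeExt F) (u, y) (1, 0) := by
  have htime : HasDerivAt (fun s => radialExt (F s) y) (fderiv ℝ (timeExt F) (u, y) (1, 0)) u :=
    HasFDerivAt.comp_hasDerivAt (f := fun s => (s, y)) u (hF.hasFDerivAt_timeExt hI hu hy)
      ((hasDerivAt_id u).prodMk (hasDerivAt_const u y))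
  simp only [radialExt_apply _ hy] at htime ⊢
  exact htime.deriv

lemma SmoothOn.hasDerivAt (hI : IsOpen I) (hF : SmoothOn I F) {u : ℝ} (hu : u ∈ I) (x : S2) :
    HasDerivAt (fun s => F s x) (deriv (fun s => F s x) u) u := by
  have htime : DifferentiableAt ℝ (fun s => timeExt F (s, x)) u :=
    DifferentiableAt.comp (f := fun s => (s, (x : E3))) u
      (hF.hasFDerivAt_timeExt hI hu (ne_zero_of_mem_unit_sphere x)).differentiableAt
      (differentiableAt_id.prodMk (differentiableAt_const _))
  simp only [timeExt, radialExt_coe] at htime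
  exact htime.hasDerivAt

lemma SmoothOn.grad_eq_fderiv (hI : IsOpen I) (hF : SmoothOn I F) {u : ℝ} (hu : u ∈ I) (x : S2)
    (A : Fin 3) :
    grad (F u) x A = fderiv ℝ (timeExt F) (u, x) (0, EuclideanSpace.single A 1) := by
  have hspace : HasFDerivAt (radialExt (F u)) _ (x : E3) :=
    (hF.hasFDerivAt_timeExt hI hu (ne_zero_of_mem_unit_sphere x)).comp (x : E3)
      (hasFDerivAt_prodMk_right u (x : E3))
  rw [grad, hspace.fderiv]
  simp

lemma SmoothOn.contDiffOn_fderiv (hI : IsOpen I) (hF : SmoothOn I F) (v : ℝ × E3) :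
    ContDiffOn ℝ ∞ (fun p => fderiv ℝ (timeExt F) p v) (I ×ˢ {0}ᶜ) :=
  (hF.contDiffOn.fderiv_of_isOpen (hI.prod isOpen_compl_singleton) (by simp)).clm_apply
    contDiffOn_const

lemma SmoothOn.deriv (hI : IsOpen I) (hF : SmoothOn I F) :
    SmoothOn I (fun u x => deriv (fun s => F s x) u) :=
  (SmoothOn.of_contDiffOn (hF.contDiffOn_fderiv hI (1, 0))).congr fun u hu x => by
    rw [← hF.deriv_radialExt hI hu (ne_zero_of_mem_unit_sphere x), radialExt_coe]

lemma SmoothOn.grad (hI : IsOpen I) (hF : SmoothOn I F) (A : Fin 3) :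
    SmoothOn I (fun u x => grad (F u) x A) :=
  (SmoothOn.of_contDiffOn (hF.contDiffOn_fderiv hI _)).congr
    fun _ hu x => hF.grad_eq_fderiv hI hu x A

lemma hasDerivAt_fderiv_inr {E : Type*} [NormedAddCommGroup E] [NormedSpace ℝ E]
    {H : ℝ × E → ℝ} {u : ℝ} {y : E} (hH : ContDiffAt ℝ 2 H (u, y)) (v : E) :
    HasDerivAt (fun s => fderiv ℝ H (s, y) (0, v))
      (fderiv ℝ (fun z => fderiv ℝ H (u, z) (1, 0)) y v) u := by
  have hsecond : HasFDerivAt (fderiv ℝ H) (fderiv ℝ (fderiv ℝ H) (u, y)) (u, y) :=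
    ((hH.fderiv_right (m := 1) le_rfl).differentiableAt one_ne_zero).hasFDerivAt
  have htime : HasDerivAt (fun s => fderiv ℝ H (s, y) (0, v))
      (fderiv ℝ (fderiv ℝ H) (u, y) (1, 0) (0, v)) u := by
    simpa using (HasFDerivAt.comp_hasDerivAt (f := fun s => (s, y)) u hsecond
      ((hasDerivAt_id u).prodMk (hasDerivAt_const u y))).clm_apply
        (hasDerivAt_const u ((0 : ℝ), v))
  have hspace : HasFDerivAt (fun z => fderiv ℝ H (u, z) (1, 0)) _ y :=
    (HasFDerivAt.comp (f := fun z => (u, z)) y hsecond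
      (hasFDerivAt_prodMk_right u y)).clm_apply (hasFDerivAt_const ((1 : ℝ), (0 : E)) y)
  rw [hspace.fderiv]
  refine htime.congr_deriv ?_
  rw [(hH.isSymmSndFDerivAt (by simp)).eq (1, 0) (0, v)]
  simp

lemma SmoothOn.hasDerivAt_grad (hI : IsOpen I) (hF : SmoothOn I F) {u : ℝ} (hu : u ∈ I) (x : S2)
    (A : Fin 3) : HasDerivAt (fun s => Scri.grad (F s) x A)
      (Scri.grad (fun y => _root_.deriv (fun s => F s y) u) x A) u := by
  have hx := ne_zero_of_mem_unit_sphere x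
  have hdot : radialExt (fun y => _root_.deriv (fun s => F s y) u) =ᶠ[𝓝 (x : E3)]
      fun z => fderiv ℝ (timeExt F) (u, z) (1, 0) :=
    (eventually_ne_nhds hx).mono fun z hz => hF.deriv_radialExt hI hu hz
  rw [Scri.grad, hdot.fderiv_eq]
  refine (hasDerivAt_fderiv_inr ((hF.contDiffAt hI hu hx).of_le (by simpa using ENat.LEInfty.out))
    _).congr_of_eventuallyEq ?_
  filter_upwards [hI.mem_nhds hu] with s hs
  exact hF.grad_eq_fderiv hI hs x A

end SmoothOn

/-! ### Calculus of the gradient -/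

section Smooth

variable {f g : S2 → ℝ}

lemma Smooth.continuous (hf : Smooth f) : Continuous f := ContMDiff.continuous hf

lemma Smooth.add (hf : Smooth f) (hg : Smooth g) : Smooth (f + g) := ContMDiff.add hf hg

lemma Smooth.sub (hf : Smooth f) (hg : Smooth g) : Smooth (f - g) := ContMDiff.sub hf hg

lemma Smooth.mul (hf : Smooth f) (hg : Smooth g) : Smooth (f * g) := ContMDiff.mul hf hg

lemma Smooth.grad (hf : Smooth f) (A : Fin 3) : Smooth (fun x => grad f x A) :=
  ((hf.smoothOn (I := Set.univ)).grad isOpen_univ A).smooth (Set.mem_univ 0)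

lemma Smooth.contDiffAt (hf : Smooth f) {y : E3} (hy : y ≠ 0) : ContDiffAt ℝ ∞ (radialExt f) y :=
  ((hf.smoothOn (I := Set.univ)).contDiffAt isOpen_univ (Set.mem_univ 0) hy).comp y
    (contDiffAt_const.prodMk contDiffAt_id)

lemma Smooth.hasFDerivAt (hf : Smooth f) {y : E3} (hy : y ≠ 0) :
    HasFDerivAt (radialExt f) (fderiv ℝ (radialExt f) y) y :=
  ((hf.contDiffAt hy).differentiableAt (by simp)).hasFDerivAt

lemma grad_add (hf : Smooth f) (hg : Smooth g) (x : S2) (A : Fin 3) :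
    grad (f + g) x A = grad f x A + grad g x A := by
  have hx := ne_zero_of_mem_unit_sphere x
  rw [grad, radialExt_add, ((hf.hasFDerivAt hx).add (hg.hasFDerivAt hx)).fderiv]
  rfl

lemma grad_mul (hf : Smooth f) (hg : Smooth g) (x : S2) (A : Fin 3) :
    grad (f * g) x A = f x * grad g x A + g x * grad f x A := by
  have hx := ne_zero_of_mem_unit_sphere x
  rw [grad, radialExt_mul, ((hf.hasFDerivAt hx).mul (hg.hasFDerivAt hx)).fderiv]
  simp [grad, radialExt_coe]

lemma grad_const (a : ℝ) (x : S2) (A : Fin 3) : grad (fun _ => a) x A = 0 := by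
  rw [grad, (radialExt_eventuallyEq _ (ne_zero_of_mem_unit_sphere x)).fderiv_eq]
  simp

lemma fderiv_radialExt_apply (f : S2 → ℝ) (x : S2) (v : E3) :
    fderiv ℝ (radialExt f) x v = ∑ A, v A * grad f x A := by
  conv_lhs => rw [← (EuclideanSpace.basisFun (Fin 3) ℝ).sum_repr v, map_sum]
  simp [grad]

lemma sum_coord_mul_grad (hf : Smooth f) (x : S2) : ∑ A, (x : E3) A * grad f x A = 0 := by
  have hray : HasDerivAt (fun s : ℝ => s • (x : E3)) (x : E3) 1 := by
    simpa using (hasDerivAt_id (1 : ℝ)).smul_const (x : E3)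
  have hconst : (fun s : ℝ => radialExt f (s • (x : E3))) =ᶠ[𝓝 1] fun _ => radialExt f x :=
    (lt_mem_nhds one_pos).mono fun s hs => radialExt_smul f hs x
  have hderiv := (hf.hasFDerivAt (ne_zero_of_mem_unit_sphere x)).comp_hasDerivAt_of_eq 1 hray
    (one_smul ℝ _).symm
  rw [← fderiv_radialExt_apply]
  exact (hderiv.congr_of_eventuallyEq hconst.symm).unique (hasDerivAt_const _ _)

lemma hasFDerivAt_norm {E : Type*} [NormedAddCommGroup E] [InnerProductSpace ℝ E] {x : E}
    (hx : x ≠ 0) : HasFDerivAt (fun y : E => ‖y‖) (‖x‖⁻¹ • innerSL ℝ x) x := by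
  have hsqrt := (hasStrictFDerivAt_norm_sq x).hasFDerivAt.sqrt (by simpa using hx)
  simp only [Real.sqrt_sq (norm_nonneg _)] at hsqrt
  refine hsqrt.congr_fderiv ?_
  ext v
  simp
  ring

lemma grad_coord (x : S2) (A B : Fin 3) : grad (fun x : S2 => (x : E3) B) x A =
    (if B = A then 1 else 0) - (x : E3) B * (x : E3) A := by
  have hx := ne_zero_of_mem_unit_sphere x
  have hcoord : radialExt (fun x : S2 => (x : E3) B) =ᶠ[𝓝 (x : E3)] fun y => ‖y‖⁻¹ * y B :=
    (eventually_ne_nhds hx).mono fun y hy => by simp [radialExt, hy]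
  have hquot : HasFDerivAt (fun y : E3 => ‖y‖⁻¹ * y B) _ (x : E3) :=
    ((hasDerivAt_inv (by simp)).comp_hasFDerivAt (x : E3) (hasFDerivAt_norm hx)).mul
      (EuclideanSpace.proj (𝕜 := ℝ) B).hasFDerivAt
  rw [grad, hcoord.fderiv_eq, hquot.fderiv]
  simp [EuclideanSpace.inner_single_right]
  ring

lemma radialExt_grad (hf : Smooth f) (A : Fin 3) {y : E3} (hy : y ≠ 0) :
    radialExt (fun x => grad f x A) y =
      ‖y‖ * fderiv ℝ (radialExt f) y (EuclideanSpace.single A 1) := by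
  have hn : 0 < ‖y‖⁻¹ := by simpa using hy
  have hscaled : HasFDerivAt (radialExt f) (‖y‖⁻¹ • fderiv ℝ (radialExt f) (‖y‖⁻¹ • y)) y := by
    have hcomp := (hf.hasFDerivAt (smul_ne_zero hn.ne' hy)).comp y
      ((hasFDerivAt_id y).const_smul ‖y‖⁻¹)
    rw [ContinuousLinearMap.comp_smul, ContinuousLinearMap.comp_id] at hcomp
    exact hcomp.congr_of_eventuallyEq (.of_forall fun z => (radialExt_smul f hn z).symm)
  rw [radialExt_apply _ hy, grad, coe_radialProj hy, hscaled.fderiv]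
  simp [hy]

lemma grad_grad (hf : Smooth f) (x : S2) (A B : Fin 3) :
    grad (fun y => grad f y B) x A = (x : E3) A * grad f x B +
      fderiv ℝ (fderiv ℝ (radialExt f)) x (EuclideanSpace.single A 1)
        (EuclideanSpace.single B 1) := by
  have hx := ne_zero_of_mem_unit_sphere x
  have hfderiv := (((hf.contDiffAt hx).fderiv_right (m := ∞) (by simp)).differentiableAt
    (by simp)).hasFDerivAt
  have hext : radialExt (fun y => grad f y B) =ᶠ[𝓝 (x : E3)]
      fun y => ‖y‖ * fderiv ℝ (radialExt f) y (EuclideanSpace.single B 1) :=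
    (eventually_ne_nhds hx).mono fun y hy => radialExt_grad hf B hy
  have hprod : HasFDerivAt
      (fun y => ‖y‖ * fderiv ℝ (radialExt f) y (EuclideanSpace.single B 1)) _ (x : E3) :=
    (hasFDerivAt_norm hx).mul
      (hfderiv.clm_apply (hasFDerivAt_const (EuclideanSpace.single B (1 : ℝ)) (x : E3)))
  rw [grad, hext.fderiv_eq, hprod.fderiv]
  simp [grad, EuclideanSpace.inner_single_right]
  ring

/- Since `f_{,A}` is extended by degree `0` but the partial derivatives of the extension of `f` have
degree `-1`, the components of the gradient commute only up to first-order terms. -/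
lemma grad_comm (hf : Smooth f) (x : S2) (A B : Fin 3) :
    grad (fun y => grad f y B) x A = grad (fun y => grad f y A) x B +
      ((x : E3) A * grad f x B - (x : E3) B * grad f x A) := by
  rw [grad_grad hf, grad_grad hf, ((hf.contDiffAt (ne_zero_of_mem_unit_sphere
    x)).isSymmSndFDerivAt (by simpa using ENat.LEInfty.out)).eq]
  ring

end Smooth

/-! ### Integration over the sphere -/

open scoped Pointwise

instance : IsFiniteMeasure area := inferInstanceAs (IsFiniteMeasure (Measure.toSphere _))

instance : area.IsOpenPosMeasure := inferInstanceAs ((Measure.toSphere _).IsOpenPosMeasure)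

lemma integrable_of_continuous {f : S2 → ℝ} (hf : Continuous f) : Integrable f area :=
  hf.integrable_of_hasCompactSupport (HasCompactSupport.of_compactSpace f)

lemma SmoothOn.hasDerivAt_integral {I : Set ℝ} {F : ℝ → S2 → ℝ} (hI : IsOpen I)
    (hF : SmoothOn I F) {u : ℝ} (hu : u ∈ I) :
    HasDerivAt (fun s => ∫ x, F s x ∂area) (∫ x, _root_.deriv (fun s => F s x) u ∂area) u := by
  obtain ⟨r, hr, hball⟩ := Metric.nhds_basis_closedBall.mem_iff.1 (hI.mem_nhds hu)
  have hcont : ContinuousOn (fun p : ℝ × S2 => _root_.deriv (fun s => F s p.2) p.1)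
      (Metric.closedBall u r ×ˢ Set.univ) :=
    (ContMDiffOn.continuousOn (hF.deriv hI)).mono (Set.prod_mono hball subset_rfl)
  obtain ⟨C, hC⟩ := ((isCompact_closedBall u r).prod
    isCompact_univ).exists_bound_of_continuousOn hcont
  refine (hasDerivAt_integral_of_dominated_loc_of_deriv_le (μ := area) (F := F)
    (F' := fun s x => _root_.deriv (fun s => F s x) s) (bound := fun _ => C)
    (Metric.ball_mem_nhds u hr) ?_ (integrable_of_continuous (hF.smooth hu).continuous)
    ((hF.deriv hI).smooth hu).continuous.aestronglyMeasurable ?_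
    (integrable_const (μ := area) C) ?_).2
  · filter_upwards [hI.mem_nhds hu] with s hs
    exact (hF.smooth hs).continuous.aestronglyMeasurable
  · exact Eventually.of_forall fun x s hs => hC (s, x) ⟨Metric.ball_subset_closedBall hs, trivial⟩
  · exact Eventually.of_forall fun x s hs =>
      hF.hasDerivAt hI (hball (Metric.ball_subset_closedBall hs)) x

section sphereMap

variable {E : Type*} [NormedAddCommGroup E] [InnerProductSpace ℝ E]

/-- The action of a linear isometry on the unit sphere. -/
def sphereMap (Φ : E ≃ₗᵢ[ℝ] E) (x : Metric.sphere (0 : E) 1) : Metric.sphere (0 : E) 1 :=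
  ⟨Φ x, by simp⟩

lemma continuous_sphereMap (Φ : E ≃ₗᵢ[ℝ] E) : Continuous (sphereMap Φ) :=
  (Φ.continuous.comp continuous_subtype_val).subtype_mk _

lemma Ioo_smul_preimage_sphereMap (Φ : E ≃ₗᵢ[ℝ] E) (s : Set (Metric.sphere (0 : E) 1)) :
    (Set.Ioo (0 : ℝ) 1) • ((↑) '' (sphereMap Φ ⁻¹' s) : Set E) =
      Φ ⁻¹' ((Set.Ioo (0 : ℝ) 1) • ((↑) '' s)) := by
  ext y
  simp only [Set.mem_smul, Set.mem_image, Set.mem_preimage]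
  constructor
  · rintro ⟨r, hr, _, ⟨x, hx, rfl⟩, rfl⟩
    exact ⟨r, hr, _, ⟨_, hx, rfl⟩, (map_smul Φ r _).symm⟩
  · rintro ⟨r, hr, _, ⟨x, hx, rfl⟩, hy⟩
    refine ⟨r, hr, _, ⟨sphereMap Φ.symm x, ?_, rfl⟩, Φ.injective ?_⟩
    · simpa [sphereMap] using hx
    · simp [sphereMap, hy]

lemma measurePreserving_sphereMap [FiniteDimensional ℝ E] [MeasurableSpace E] [BorelSpace E]
    (Φ : E ≃ₗᵢ[ℝ] E) : MeasurePreserving (sphereMap Φ)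
      (volume : Measure E).toSphere (volume : Measure E).toSphere := by
  have hm := (continuous_sphereMap Φ).measurable
  refine ⟨hm, ?_⟩
  ext s hs
  rw [Measure.map_apply hm hs, Measure.toSphere_apply' _ hs, Measure.toSphere_apply' _ (hm hs),
    Ioo_smul_preimage_sphereMap,
    Φ.measurePreserving.measure_preimage_emb Φ.toMeasurableEquiv.measurableEmbedding]

end sphereMap

lemma integral_comp_sphereMap (Φ : E3 ≃ₗᵢ[ℝ] E3) {f : S2 → ℝ} (hf : Continuous f) :
    ∫ x, f (sphereMap Φ x) ∂area = ∫ x, f x ∂area := by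
  have hΦ : MeasurePreserving (sphereMap Φ) area area := measurePreserving_sphereMap Φ
  conv_rhs => rw [← hΦ.map_eq]
  rw [integral_map hΦ.measurable.aemeasurable hf.aestronglyMeasurable]

section planeRotation

variable {ι : Type*} [Fintype ι] [DecidableEq ι] {i j : ι} (hij : i ≠ j)

/-- The rotation by the angle `t` in the plane of the coordinates `i` and `j`. -/
def planeRotation (t : ℝ) : EuclideanSpace ℝ ι ≃ₗᵢ[ℝ] EuclideanSpace ℝ ι :=
  LinearIsometry.toLinearIsometryEquiv
    { toFun := fun y => y +
        ((Real.cos t - 1) * y i - Real.sin t * y j) • EuclideanSpace.single i 1 +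
        (Real.sin t * y i + (Real.cos t - 1) * y j) • EuclideanSpace.single j 1
      map_add' := fun y z => by
        simp only [PiLp.add_apply]
        module
      map_smul' := fun r y => by
        simp only [PiLp.smul_apply, smul_eq_mul, RingHom.id_apply]
        module
      norm_map' := fun y => by
        rw [← sq_eq_sq₀ (norm_nonneg _) (norm_nonneg _)]
        simp [norm_add_sq_real, inner_add_left, inner_smul_left, inner_smul_right, norm_smul,
          EuclideanSpace.inner_single_right, hij]
        linear_combination (y i ^ 2 + y j ^ 2) * Real.sin_sq_add_cos_sq t } rfl

lemma planeRotation_apply (t : ℝ) (y : EuclideanSpace ℝ ι) : planeRotation hij t y =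
    y + ((Real.cos t - 1) * y i - Real.sin t * y j) • EuclideanSpace.single i 1 +
      (Real.sin t * y i + (Real.cos t - 1) * y j) • EuclideanSpace.single j 1 := rfl

lemma planeRotation_zero (y : EuclideanSpace ℝ ι) : planeRotation hij 0 y = y := by
  simp [planeRotation_apply]

lemma contDiff_planeRotation :
    ContDiff ℝ ∞ (fun p : ℝ × EuclideanSpace ℝ ι => planeRotation hij p.1 p.2) := by
  simp only [planeRotation_apply]
  fun_prop

lemma hasDerivAt_planeRotation (y : EuclideanSpace ℝ ι) :
    HasDerivAt (fun t => planeRotation hij t y)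
      (y i • EuclideanSpace.single j 1 - y j • EuclideanSpace.single i 1) 0 := by
  have hcos := (Real.hasDerivAt_cos 0).sub_const 1
  have hsin := Real.hasDerivAt_sin 0
  refine ((((((hcos.mul_const (y i)).sub (hsin.mul_const (y j))).smul_const
    (EuclideanSpace.single i (1 : ℝ)))).const_add y).add
    ((((hsin.mul_const (y i)).add (hcos.mul_const (y j))).smul_const
    (EuclideanSpace.single j (1 : ℝ))))).congr_deriv ?_
  simp
  abel

end planeRotation

lemma Smooth.smoothOn_comp_planeRotation {i j : Fin 3} (hij : i ≠ j) {f : S2 → ℝ}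
    (hf : Smooth f) : SmoothOn Set.univ (fun t x => f (sphereMap (planeRotation hij t) x)) := by
  have hext : ContDiffOn ℝ ∞ (fun p : ℝ × E3 => radialExt f (planeRotation hij p.1 p.2))
      (Set.univ ×ˢ {0}ᶜ) := fun p hp =>
    ((hf.contDiffAt (by simpa using hp)).comp p
      (contDiff_planeRotation hij).contDiffAt).contDiffWithinAt
  exact (SmoothOn.of_contDiffOn hext).congr fun t _ x =>
    (radialExt_coe f (sphereMap (planeRotation hij t) x)).symm

lemma Smooth.hasDerivAt_comp_planeRotation {i j : Fin 3} (hij : i ≠ j) {f : S2 → ℝ}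
    (hf : Smooth f) (x : S2) :
    HasDerivAt (fun t => f (sphereMap (planeRotation hij t) x))
      ((x : E3) i * Scri.grad f x j - (x : E3) j * Scri.grad f x i) 0 := by
  have hext := (hf.hasFDerivAt (ne_zero_of_mem_unit_sphere x)).comp_hasDerivAt_of_eq 0
    (hasDerivAt_planeRotation hij (x : E3)) (planeRotation_zero hij _).symm
  exact (hext.congr_deriv (by simp [Scri.grad])).congr_of_eventuallyEq <| .of_forall fun t =>
    (radialExt_coe f (sphereMap (planeRotation hij t) x)).symm

lemma integral_mul_grad_sub_mul_grad {i j : Fin 3} (hij : i ≠ j) {f : S2 → ℝ} (hf : Smooth f) :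
    ∫ x : S2, ((x : E3) i * grad f x j - (x : E3) j * grad f x i) ∂area = 0 := by
  have hderiv := (hf.smoothOn_comp_planeRotation hij).hasDerivAt_integral isOpen_univ
    (Set.mem_univ 0)
  simp only [integral_comp_sphereMap _ hf.continuous,
    (hf.hasDerivAt_comp_planeRotation hij _).deriv] at hderiv
  exact hderiv.unique (hasDerivAt_const _ _)

/-! ### The algebra of smooth functions on the sphere -/

/-- The algebra of smooth functions on the sphere. -/
def smoothAlg : Subalgebra ℝ (S2 → ℝ) where
  carrier := {f | Smooth f}
  mul_mem' := Smooth.mul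
  add_mem' := Smooth.add
  algebraMap_mem' r := smooth_const r

/-- The tangential derivatives `f_{||A}` as derivations of the algebra of smooth functions. -/
def tangentialDeriv (A : Fin 3) : Derivation ℝ smoothAlg smoothAlg :=
  Derivation.mk'
    { toFun f := ⟨fun x => grad f x A, f.2.grad A⟩
      map_add' f g := Subtype.ext <| funext fun x => grad_add f.2 g.2 x A
      map_smul' r f := Subtype.ext <| funext fun x => by
        simpa [grad_const] using! grad_mul (smooth_const r) f.2 x A }
    fun f g => Subtype.ext <| funext fun x => grad_mul f.2 g.2 x A

/-- The integral over the sphere as a linear functional on the algebra of smooth functions. -/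
def smoothInt : smoothAlg →ₗ[ℝ] ℝ where
  toFun f := ∫ x, (f : S2 → ℝ) x ∂area
  map_add' f g := integral_add (integrable_of_continuous (Smooth.continuous f.2))
    (integrable_of_continuous (Smooth.continuous g.2))
  map_smul' r _ := integral_const_mul r _

/-- The Cartesian coordinates as elements of the algebra of smooth functions. -/
def coord (A : Fin 3) : smoothAlg := ⟨fun x => (x : E3) A, smooth_coord A⟩

lemma coe_sum {ι : Type*} (s : Finset ι) (f : ι → smoothAlg) (x : S2) :
    ((∑ i ∈ s, f i : smoothAlg) : S2 → ℝ) x = ∑ i ∈ s, (f i : S2 → ℝ) x := by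
  simp

lemma coe_dotProduct (v w : Fin 3 → smoothAlg) (x : S2) :
    ((v ⬝ᵥ w : smoothAlg) : S2 → ℝ) x = ∑ A, (v A : S2 → ℝ) x * (w A : S2 → ℝ) x :=
  coe_sum _ _ x

lemma coord_dotProduct_coord : coord ⬝ᵥ coord = 1 := by
  ext x
  have hx : ‖(x : E3)‖ ^ 2 = 1 := by simp
  rw [EuclideanSpace.norm_sq_eq] at hx
  rw [coe_dotProduct]
  simpa [sq, coord] using! hx

lemma coord_dotProduct_tangentialDeriv (f : smoothAlg) :
    (coord ⬝ᵥ fun A => tangentialDeriv A f) = 0 := by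
  ext x
  rw [coe_dotProduct]
  exact sum_coord_mul_grad f.2 x

lemma tangentialDeriv_coord (A B : Fin 3) :
    tangentialDeriv A (coord B) = (if B = A then 1 else 0) - coord B * coord A := by
  ext x
  refine (grad_coord x A B).trans ?_
  split_ifs <;> rfl

lemma smoothInt_coord_mul_sub (A B : Fin 3) (f : smoothAlg) :
    smoothInt (coord B * tangentialDeriv A f - coord A * tangentialDeriv B f) = 0 := by
  obtain rfl | hBA := eq_or_ne B A
  · simp
  · exact integral_mul_grad_sub_mul_grad hBA f.2

lemma smoothInt_tangentialDeriv (A : Fin 3) (f : smoothAlg) :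
    smoothInt (tangentialDeriv A f) = smoothInt (2 • (coord A * f)) := by
  have hsum : ∑ B, (coord B * tangentialDeriv A (coord B * f)
      - coord A * tangentialDeriv B (coord B * f)) =
      tangentialDeriv A f - 2 • (coord A * f) := by
    have hx := coord_dotProduct_coord
    have hδ := coord_dotProduct_tangentialDeriv f
    simp only [dotProduct, Fin.sum_univ_three] at hx hδ
    simp only [Derivation.leibniz, smul_eq_mul, tangentialDeriv_coord, Fin.sum_univ_three,
      two_smul]
    fin_cases A <;> simp only [Fin.isValue, Fin.reduceEq, Fin.reduceFinMk, Fin.mk_one,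
      Fin.zero_eta, if_true, if_false]
    · linear_combination tangentialDeriv 0 f * hx - coord 0 * hδ
    · linear_combination tangentialDeriv 1 f * hx - coord 1 * hδ
    · linear_combination tangentialDeriv 2 f * hx - coord 2 * hδ
  rw [← sub_eq_zero, ← map_sub, ← hsum, map_sum]
  exact Finset.sum_eq_zero fun B _ => smoothInt_coord_mul_sub A B (coord B * f)

/-- The calculus of smooth functions on the round sphere. -/
def sph : SphereCalculus smoothAlg where
  x := coord
  δ := tangentialDeriv
  int := smoothInt
  x_dotProduct_x := coord_dotProduct_coord
  x_dotProduct_δ := coord_dotProduct_tangentialDeriv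
  δ_x := tangentialDeriv_coord
  δ_comm A B f := Subtype.ext <| funext fun x => grad_comm f.2 x A B
  int_δ := smoothInt_tangentialDeriv

lemma sph_int_apply (f : smoothAlg) : sph.int f = ∫ x, (f : S2 → ℝ) x ∂area := rfl

lemma coe_δ (A : Fin 3) (f : smoothAlg) (x : S2) : (sph.δ A f : S2 → ℝ) x = grad f x A := rfl

lemma coe_x (A : Fin 3) (x : S2) : (sph.x A : S2 → ℝ) x = (x : E3) A := rfl

lemma coe_two_nsmul (f : smoothAlg) (x : S2) :
    ((2 • f : smoothAlg) : S2 → ℝ) x = 2 * (f : S2 → ℝ) x := by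
  rw [two_smul, two_mul]
  rfl

lemma coe_h (A B : Fin 3) (x : S2) : (sph.h A B : S2 → ℝ) x = metric x A B := by
  simp only [SphereCalculus.h, metric, Matrix.of_apply]
  split_ifs <;> rfl

lemma coe_ε (A B : Fin 3) (x : S2) : (sph.ε A B : S2 → ℝ) x = vol x A B := by
  simp only [SphereCalculus.ε, vol, Matrix.det_fin_three]
  fin_cases A <;> fin_cases B <;> simp [coe_x]

lemma coe_covD1 (v : Fin 3 → smoothAlg) (x : S2) (A B : Fin 3) :
    (sph.covD1 v A B : S2 → ℝ) x = covD1 (fun y a => (v a : S2 → ℝ) y) x A B := by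
  simp [SphereCalculus.covD1_eq, Matrix.mul_apply, covD1, coe_h, coe_δ]

lemma coe_covD2 (T : Matrix (Fin 3) (Fin 3) smoothAlg) (x : S2) (A B C : Fin 3) :
    (sph.covD2 T A B C : S2 → ℝ) x = covD2 (fun y a b => (T a b : S2 → ℝ) y) x A B C := by
  simp [SphereCalculus.covD2, covD2, coe_h, coe_δ]

lemma coe_covDD2 (T : Matrix (Fin 3) (Fin 3) smoothAlg) (x : S2) (A B C D : Fin 3) :
    (sph.covD3 (sph.covD2 T) A B C D : S2 → ℝ) x =
      covDD2 (fun y a b => (T a b : S2 → ℝ) y) x A B C D := by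
  simp [SphereCalculus.covD3, covDD2, covD3, coe_h, coe_δ, ← coe_covD2]

lemma coe_div2 (T : Matrix (Fin 3) (Fin 3) smoothAlg) (x : S2) (A : Fin 3) :
    (sph.div2 T A : S2 → ℝ) x = div2 (fun y a b => (T a b : S2 → ℝ) y) x A := by
  simp [SphereCalculus.div2, div2, coe_covD2]

lemma coe_hess (f : smoothAlg) (x : S2) (A B : Fin 3) :
    (sph.hess f A B : S2 → ℝ) x = hess f x A B :=
  coe_covD1 (sph.grad f) x A B

lemma coe_lap (f : smoothAlg) (x : S2) : (sph.lap f : S2 → ℝ) x = lap f x := by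
  simp [← SphereCalculus.trace_hess, Matrix.trace, lap, coe_hess]

lemma coe_lapAddTwo (f : smoothAlg) (x : S2) :
    (sph.lapAddTwo f : S2 → ℝ) x = lap f x + 2 * (f : S2 → ℝ) x := by
  rw [SphereCalculus.lapAddTwo_apply, ← coe_lap, ← coe_two_nsmul]
  rfl

lemma coe_lap_lapAddTwo (f : smoothAlg) (x : S2) :
    (sph.lap (sph.lapAddTwo f) : S2 → ℝ) x = lapLap2 f x := by
  rw [coe_lap, lapLap2, funext (coe_lapAddTwo f)]

lemma coe_electric (c : smoothAlg) (x : S2) (A B : Fin 3) :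
    (sph.electric c A B : S2 → ℝ) x = 2 * hess c x A B - metric x A B * lap c x := by
  rw [← coe_hess, ← coe_lap, ← coe_h, ← coe_two_nsmul, mul_comm]
  rfl

lemma coe_tensorOfPotentials (c b : smoothAlg) (x : S2) (A B : Fin 3) :
    (sph.tensorOfPotentials c b A B : S2 → ℝ) x = tensorOfPotentials c b x A B := by
  rw [tensorOfPotentials, ← coe_electric, SphereCalculus.tensorOfPotentials,
    SphereCalculus.magnetic_eq]
  simp [Matrix.mul_apply, coe_ε, coe_hess, add_assoc, mul_comm]

lemma coe_dipole (a : E3) : (sph.dipole a : S2 → ℝ) = dipole a := by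
  ext x
  simp [SphereCalculus.dipole, dipole, coe_x, PiLp.inner_apply, mul_comm]

lemma coe_rot (a : E3) (x : S2) (A : Fin 3) : (sph.rot a A : S2 → ℝ) x = rot a x A := by
  simp [SphereCalculus.rot, SphereCalculus.curl_eq, Matrix.mulVec, coe_dotProduct, rot, coe_ε,
    coe_δ, coe_dipole]

lemma coe_rotDeriv (a : E3) (g : smoothAlg) (x : S2) :
    (sph.rotDeriv a g : S2 → ℝ) x = ∑ A, rot a x A * grad g x A := by
  simp [SphereCalculus.rotDeriv_apply, coe_dotProduct, coe_rot, coe_δ]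

lemma coe_boostDeriv (a : E3) (g : smoothAlg) (x : S2) :
    (sph.boostDeriv a g : S2 → ℝ) x = ∑ A, grad (dipole a) x A * grad g x A := by
  simp [SphereCalculus.boostDeriv_apply, coe_dotProduct, coe_dipole, coe_δ]

/-! ### Uniqueness of the potentials -/

namespace SphereCalculus

variable {𝒜 : Type*} [CommRing 𝒜] [Algebra ℝ 𝒜] (S : SphereCalculus 𝒜)

lemma lap_δ_add_mul_x {c : 𝒜} (hc : S.lapAddTwo c = 0) (A : Fin 3) :
    S.lap (S.δ A c + c * S.x A) = 0 := by
  have hlap : S.lap c = -(2 * c) := by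
    rw [lapAddTwo_apply, two_smul, ← two_mul] at hc
    exact eq_neg_of_add_eq_zero_left hc
  rw [map_add, lap_mul, lap_δ, lap_x, hlap, grad_dotProduct_grad_x, map_neg, two_mul c, map_add]
  ring

lemma sum_δ_add_mul_x_mul_x (c : 𝒜) : ∑ A, (S.δ A c + c * S.x A) * S.x A = c := by
  rw [Fin.sum_univ_three]
  linear_combination S.sum_x_mul_δ c + c * S.sum_x_sq

end SphereCalculus

lemma smoothInt_mul_self_nonneg (f : smoothAlg) : 0 ≤ sph.int (f * f) :=
  integral_nonneg fun x => mul_self_nonneg ((f : S2 → ℝ) x)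

lemma eq_zero_of_smoothInt_mul_self {f : smoothAlg} (hf : sph.int (f * f) = 0) : f = 0 := by
  have hc : Continuous fun x => (f : S2 → ℝ) x * (f : S2 → ℝ) x :=
    (Smooth.continuous f.2).mul (Smooth.continuous f.2)
  have hae := (integral_eq_zero_iff_of_nonneg (fun x => mul_self_nonneg ((f : S2 → ℝ) x))
    (integrable_of_continuous hc)).1 hf
  have hzero := (hc.ae_eq_iff_eq area continuous_const).1 hae
  ext x
  exact mul_self_eq_zero.1 (congrFun hzero x)

lemma smoothInt_one_pos : 0 < sph.int 1 := by
  refine lt_of_le_of_ne (by simpa using smoothInt_mul_self_nonneg 1) fun hint => ?_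
  have hone := eq_zero_of_smoothInt_mul_self ((congrArg sph.int (one_mul 1)).trans hint.symm)
  exact one_ne_zero (congrFun (congrArg Subtype.val hone) (radialProj 0))

lemma exists_eq_algebraMap_of_δ_eq_zero {f : smoothAlg} (hf : ∀ A, sph.δ A f = 0) :
    ∃ r : ℝ, f = algebraMap ℝ smoothAlg r := by
  have hfderiv : Set.EqOn (fderiv ℝ (radialExt f)) 0 ({0}ᶜ : Set E3) := fun y hy => by
    have hbasis (A : Fin 3) : fderiv ℝ (radialExt f) y (EuclideanSpace.single A 1) = 0 := by
      have hext := radialExt_grad f.2 A hy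
      rw [radialExt_apply _ hy, ← coe_δ, hf] at hext
      exact (mul_eq_zero.1 hext.symm).resolve_left (norm_ne_zero_iff.2 hy)
    ext v
    rw [← (EuclideanSpace.basisFun (Fin 3) ℝ).sum_repr v, map_sum]
    simp [hbasis]
  have hconn : IsPreconnected ({0}ᶜ : Set E3) :=
    (isConnected_compl_singleton_of_one_lt_rank (by simp [← Module.finrank_eq_rank])
      0).isPreconnected
  refine ⟨(f : S2 → ℝ) (radialProj 0), ?_⟩
  ext x
  have hconst := isOpen_compl_singleton.is_const_of_fderiv_eq_zero (𝕜 := ℝ) hconn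
    (fun y hy => (Smooth.hasFDerivAt f.2 hy).differentiableAt.differentiableWithinAt) hfderiv
    (ne_zero_of_mem_unit_sphere x) (ne_zero_of_mem_unit_sphere (radialProj 0))
  rwa [radialExt_coe, radialExt_coe] at hconst

lemma exists_eq_algebraMap_of_lap_eq_zero {f : smoothAlg} (hf : sph.lap f = 0) :
    ∃ r : ℝ, f = algebraMap ℝ smoothAlg r := by
  have hdirichlet : ∑ A, sph.int (sph.δ A f * sph.δ A f) = 0 := by
    rw [← map_sum]
    have hparts := sph.int_mul_lap f f
    rw [hf, mul_zero, map_zero] at hparts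
    exact neg_eq_zero.1 hparts.symm
  have hterm := (Finset.sum_eq_zero_iff_of_nonneg fun A _ =>
    smoothInt_mul_self_nonneg (sph.δ A f)).1 hdirichlet
  exact exists_eq_algebraMap_of_δ_eq_zero fun A =>
    eq_zero_of_smoothInt_mul_self (hterm A (Finset.mem_univ A))

lemma lapAddTwo_eq_zero_of_lap_eq_zero {c : smoothAlg} (hc : sph.lap (sph.lapAddTwo c) = 0)
    (hint : sph.int c = 0) : sph.lapAddTwo c = 0 := by
  obtain ⟨r, hr⟩ := exists_eq_algebraMap_of_lap_eq_zero hc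
  have hmean : sph.int (sph.lapAddTwo c) = 0 := by
    rw [SphereCalculus.lapAddTwo_apply, map_add, sph.int_lap, map_nsmul, hint, smul_zero, add_zero]
  apply eq_zero_of_smoothInt_mul_self
  nth_rewrite 1 [hr]
  rw [← Algebra.smul_def, map_smul, hmean, smul_zero]

/- If `D² c = -2 c`, each `δ_A c + c x_A` is harmonic, hence a constant `r_A`, and contracting with
`x` gives `c = ∑ r_A x_A`. -/
lemma eq_zero_of_lap_lapAddTwo_eq_zero {c : smoothAlg} (hc : sph.lap (sph.lapAddTwo c) = 0)
    (hint : sph.int c = 0) (hdip : ∀ A, sph.int (c * sph.x A) = 0) : c = 0 := by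
  have hker := lapAddTwo_eq_zero_of_lap_eq_zero hc hint
  choose r hr using fun A => exists_eq_algebraMap_of_lap_eq_zero (sph.lap_δ_add_mul_x hker A)
  have hdipole : c = ∑ A, r A • sph.x A := by
    conv_lhs => rw [← sph.sum_δ_add_mul_x_mul_x c]
    simp only [hr, Algebra.smul_def]
  apply eq_zero_of_smoothInt_mul_self
  nth_rewrite 2 [hdipole]
  simp [Finset.mul_sum, hdip]

lemma IsElectricPotential.unique {T : S2 → Fin 3 → Fin 3 → ℝ} {c c' : S2 → ℝ}
    (h : IsElectricPotential T c) (h' : IsElectricPotential T c') : c = c' := by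
  let C : smoothAlg := ⟨c, h.smooth⟩
  let C' : smoothAlg := ⟨c', h'.smooth⟩
  suffices C - C' = 0 from congrArg Subtype.val (sub_eq_zero.1 this)
  refine eq_zero_of_lap_lapAddTwo_eq_zero ?_ ?_ fun A => ?_
  · rw [map_sub, map_sub, sub_eq_zero]
    ext x
    rw [coe_lap_lapAddTwo, coe_lap_lapAddTwo]
    exact (h.eq x).trans (h'.eq x).symm
  · rw [map_sub, show sph.int C = 0 from h.noMonopole, show sph.int C' = 0 from h'.noMonopole,
      sub_zero]
  · rw [sub_mul, map_sub, show sph.int (C * sph.x A) = 0 from h.noDipole A,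
      show sph.int (C' * sph.x A) = 0 from h'.noDipole A, sub_zero]

lemma IsElectricPotential.electricPotential_eq {T : S2 → Fin 3 → Fin 3 → ℝ} {c : S2 → ℝ}
    (h : IsElectricPotential T c) : electricPotential T = c := by
  have hex : ∃ c, IsElectricPotential T c := ⟨c, h⟩
  rw [electricPotential, dif_pos hex]
  exact hex.choose_spec.unique h

section ArePotentials

variable {T : S2 → Fin 3 → Fin 3 → ℝ} {c b : S2 → ℝ}

lemma ArePotentials.eq_tensorOfPotentials (h : ArePotentials T c b) : T = fun x A B =>
    (sph.tensorOfPotentials ⟨c, h.smooth_c⟩ ⟨b, h.smooth_b⟩ A B : S2 → ℝ) x := by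
  funext x A B
  rw [coe_tensorOfPotentials, h.eq]

lemma ArePotentials.electricPotential_eq (h : ArePotentials T c b) : electricPotential T = c := by
  refine IsElectricPotential.electricPotential_eq ⟨h.smooth_c, h.c_noMonopole, h.c_noDipole,
    fun x => ?_⟩
  simp only [h.eq_tensorOfPotentials, ← coe_covDD2, ← coe_sum,
    sph.sum_covD3_covD2_tensorOfPotentials, coe_lap_lapAddTwo]

end ArePotentials

/-! ### Supertranslations of stationary data -/

lemma JWith_eq_charge (a : E3) {d : ScriData} {u : ℝ} {T : Matrix (Fin 3) (Fin 3) smoothAlg}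
    {ν : Fin 3 → smoothAlg} {μ : smoothAlg} (hχ : d.χ u = fun x A B => (T A B : S2 → ℝ) x)
    (hN : ∀ x A, d.N u x A = (ν A : S2 → ℝ) x) (hm : d.m u = μ) (c : smoothAlg) :
    JWith a d u c = 1 / (8 * Real.pi) * sph.charge a μ ν T c := by
  have hCJK : ∫ x, ∑ A, (3 * d.N u x A + 1 / 4 * ∑ B, d.χ u x A B * div2 (d.χ u) x B) * rot a x A
      ∂area = 3 * sph.int (ν ⬝ᵥ sph.rot a) + 1 / 4 * sph.int (T *ᵥ sph.div2 T ⬝ᵥ sph.rot a) := by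
    rw [← smul_eq_mul, ← smul_eq_mul, ← map_smul, ← map_smul, ← map_add, sph_int_apply]
    congr with x
    simp [coe_dotProduct, Matrix.mulVec, hχ, hN, coe_rot, coe_div2, add_mul,
      Finset.sum_add_distrib, mul_assoc, ← Finset.mul_sum]
  have hmass : ∫ x, d.m u x * ∑ A, rot a x A * grad c x A ∂area =
      sph.int (μ * sph.rotDeriv a c) := by
    rw [sph_int_apply]
    congr with x
    simp [hm, coe_rotDeriv]
  rw [JWith, JCJK, hCJK, hmass, SphereCalculus.charge]
  ring

lemma ScriData.χdot_eq_zero {I : Set ℝ} {d : ScriData}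
    (hχ : ∀ u ∈ I, ∀ x A B, d.χdot u x A B = 0) {u : ℝ} (hu : u ∈ I) : d.χdot u = 0 := by
  funext x A B
  exact hχ u hu x A B

lemma ScriData.χddot_eq_zero {I : Set ℝ} (hI : IsOpen I) {d : ScriData}
    (hχ : ∀ u ∈ I, ∀ x A B, d.χdot u x A B = 0) {u : ℝ} (hu : u ∈ I) : d.χddot u = 0 := by
  funext x A B
  have hzero : (fun s => d.χdot s x A B) =ᶠ[𝓝 u] fun _ => 0 :=
    (hI.eventually_mem hu).mono fun s hs => hχ s hs x A B
  rw [ScriData.χddot, hzero.deriv_eq, deriv_const]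
  rfl

lemma div2_zero (x : S2) (A : Fin 3) : div2 0 x A = 0 := by
  simp [div2, covD2, grad_const]

section Stationary

variable {d : ScriData} {u : ℝ} {T : Matrix (Fin 3) (Fin 3) smoothAlg} {ν : Fin 3 → smoothAlg}
  {μ : smoothAlg}

lemma supertranslate_χ (f : smoothAlg) {c b : smoothAlg}
    (hχ : d.χ u = fun x A B => (sph.tensorOfPotentials c b A B : S2 → ℝ) x) :
    (d.supertranslate f).χ u =
      fun x A B => (sph.tensorOfPotentials (c - f) b A B : S2 → ℝ) x := by
  funext x A B
  have hsub : sph.tensorOfPotentials (c - f) b A B =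
      sph.tensorOfPotentials c b A B - sph.electric f A B := by
    rw [SphereCalculus.tensorOfPotentials, map_sub, sub_add_eq_add_sub]
    rfl
  simp only [ScriData.supertranslate, hχ, hsub]
  simp only [AddSubgroupClass.coe_sub, Pi.sub_apply, coe_electric]
  ring

lemma supertranslate_m (f : S2 → ℝ) (hdot : d.χdot u = 0) (hddot : d.χddot u = 0) :
    (d.supertranslate f).m u = d.m u := by
  funext x
  simp [ScriData.supertranslate, hdot, hddot, div2_zero]

lemma supertranslate_N (f : smoothAlg) (hdot : d.χdot u = 0) (hddot : d.χddot u = 0)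
    (hχ : d.χ u = fun x A B => (T A B : S2 → ℝ) x)
    (hN : ∀ x A, d.N u x A = (ν A : S2 → ℝ) x) (hm : d.m u = μ) (x : S2) (A : Fin 3) :
    (d.supertranslate f).N u x A = (sph.supertranslatedAspect f μ ν T A : S2 → ℝ) x := by
  have hcov (A C : Fin 3) : ∑ B, covDD2 (d.χ u) x A B B C =
      (sph.covD1 (sph.div2 T) A C : S2 → ℝ) x := by
    rw [← sph.sum_covD3_covD2, coe_sum]
    simp only [coe_covDD2, hχ]
  have hrhs : (sph.supertranslatedAspect f μ ν T A : S2 → ℝ) x = (ν A : S2 → ℝ) x -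
      (μ : S2 → ℝ) x * grad f x A + 1 / 4 * ∑ C, ((sph.covD1 (sph.div2 T) A C : S2 → ℝ) x -
        (sph.covD1 (sph.div2 T) C A : S2 → ℝ) x) * grad f x C := by
    simp [SphereCalculus.supertranslatedAspect, coe_dotProduct, Matrix.mulVec, coe_δ]
  rw [hrhs]
  simp only [← hcov, sub_mul, Finset.sum_sub_distrib, Finset.sum_mul]
  rw [Finset.sum_comm, Finset.sum_comm (f := fun C B => covDD2 (d.χ u) x C B B A * grad f x C)]
  simp only [ScriData.supertranslate, hdot, hddot, div2_zero, hN, hm, mul_comm (grad f x _)]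
  simp only [Pi.zero_apply, zero_mul, mul_zero, Finset.sum_const_zero]
  ring

lemma int_mul_sum_grad_dipole (a : E3) (f b : smoothAlg) :
    ∫ x, (f : S2 → ℝ) x * ∑ A, grad (dipole a) x A * grad (lapLap2 b) x A ∂area =
      sph.int (f * sph.boostDeriv a (sph.lap (sph.lapAddTwo b))) := by
  rw [sph_int_apply, ← funext (coe_lap_lapAddTwo b)]
  simp only [← coe_boostDeriv]
  rfl

variable {f c b : S2 → ℝ}

lemma JWith_supertranslate (hdot : d.χdot u = 0) (hddot : d.χddot u = 0) (hm : Smooth (d.m u))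
    (hN : ∀ A, Smooth fun x => d.N u x A) (hf : Smooth f) (hcb : ArePotentials (d.χ u) c b)
    (a : E3) :
    JWith a (d.supertranslate f) u (fun x => c x - f x) = J a d u + 1 / (32 * Real.pi) *
      ∫ x, f x * ∑ A, grad (dipole a) x A * grad (lapLap2 b) x A ∂area := by
  let C : smoothAlg := ⟨c, hcb.smooth_c⟩
  let B : smoothAlg := ⟨b, hcb.smooth_b⟩
  let F : smoothAlg := ⟨f, hf⟩
  let μ : smoothAlg := ⟨d.m u, hm⟩
  let ν (A : Fin 3) : smoothAlg := ⟨fun x => d.N u x A, hN A⟩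
  have hχ : d.χ u = fun x A A' => (sph.tensorOfPotentials C B A A' : S2 → ℝ) x :=
    hcb.eq_tensorOfPotentials
  have hbefore : J a d u = 1 / (8 * Real.pi) * sph.charge a μ ν (sph.tensorOfPotentials C B) C := by
    rw [J, hcb.electricPotential_eq]
    exact JWith_eq_charge a hχ (fun _ _ => rfl) rfl C
  have hafter : JWith a (d.supertranslate f) u (C - F : smoothAlg) = 1 / (8 * Real.pi) *
      sph.charge a μ (sph.supertranslatedAspect F μ ν (sph.tensorOfPotentials C B))
        (sph.tensorOfPotentials (C - F) B) (C - F) :=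
    JWith_eq_charge a (supertranslate_χ F hχ)
      (supertranslate_N F hdot hddot hχ (fun _ _ => rfl) rfl) (supertranslate_m f hdot hddot) _
  refine hafter.trans ?_
  rw [SphereCalculus.charge_supertranslated, hbefore,
    show ∫ x, f x * _ ∂area = _ from int_mul_sum_grad_dipole a F B]
  ring

lemma grad_add_const (hf : Smooth f) (r : ℝ) (x : S2) (A : Fin 3) :
    grad (f + fun _ => r) x A = grad f x A := by
  rw [grad_add hf (smooth_const r), grad_const, add_zero]

lemma electricPotential_supertranslate (hf : Smooth f) (hfd : NoDipole f)
    (hcb : ArePotentials (d.χ u) c b) :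
    ∃ r : ℝ, electricPotential ((d.supertranslate f).χ u) = (c - f) + fun _ => r := by
  let C : smoothAlg := ⟨c, hcb.smooth_c⟩
  let B : smoothAlg := ⟨b, hcb.smooth_b⟩
  let F : smoothAlg := ⟨f, hf⟩
  have hC : sph.int C = 0 := hcb.c_noMonopole
  have hCx (A : Fin 3) : sph.int (C * sph.x A) = 0 := hcb.c_noDipole A
  have hFx (A : Fin 3) : sph.int (F * sph.x A) = 0 := hfd A
  obtain ⟨r, hr⟩ : ∃ r : ℝ, r * sph.int 1 = sph.int F :=
    ⟨sph.int F / sph.int 1, div_mul_cancel₀ _ smoothInt_one_pos.ne'⟩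
  have hpot : ArePotentials ((d.supertranslate f).χ u)
      (C - F + algebraMap ℝ smoothAlg r : smoothAlg) b := by
    refine ⟨Subtype.property _, hcb.smooth_b, ?_, fun A => ?_, hcb.b_noMonopole, hcb.b_noDipole,
      fun x A A' => ?_⟩
    · change sph.int (C - F + algebraMap ℝ smoothAlg r) = 0
      rw [Algebra.algebraMap_eq_smul_one, map_add, map_sub, map_smul, smul_eq_mul, hC, hr]
      ring
    · change sph.int ((C - F + algebraMap ℝ smoothAlg r) * sph.x A) = 0
      rw [Algebra.algebraMap_eq_smul_one, add_mul, sub_mul, smul_one_mul, map_add, map_sub,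
        map_smul, hCx, hFx, sph.int_x, sub_zero, smul_zero, add_zero]
    · rw [supertranslate_χ F hcb.eq_tensorOfPotentials,
        ← coe_tensorOfPotentials (C - F + algebraMap ℝ smoothAlg r) B]
      simp only [SphereCalculus.tensorOfPotentials, map_add, sph.electric_algebraMap, add_zero]
      rfl
  exact ⟨r, hpot.electricPotential_eq⟩

lemma J_supertranslate (hdot : d.χdot u = 0) (hddot : d.χddot u = 0) (hm : Smooth (d.m u))
    (hN : ∀ A, Smooth fun x => d.N u x A) (hf : Smooth f) (hfd : NoDipole f)
    (hcb : ArePotentials (d.χ u) c b) (a : E3) :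
    J a (d.supertranslate f) u = J a d u + 1 / (32 * Real.pi) *
      ∫ x, f x * ∑ A, grad (dipole a) x A * grad (lapLap2 b) x A ∂area := by
  obtain ⟨r, hr⟩ := electricPotential_supertranslate hf hfd hcb
  rw [← JWith_supertranslate hdot hddot hm hN hf hcb a, J, hr, JWith, JWith]
  simp only [grad_add_const (hcb.smooth_c.sub hf)]
  rfl

end Stationary

/-! ### The flux of angular momentum -/

lemma smooth_metric (A B : Fin 3) : Smooth (fun x => metric x A B) := by
  rw [← funext (coe_h A B)]
  exact (sph.h A B).2

lemma smooth_rot (a : E3) (A : Fin 3) : Smooth (fun x => rot a x A) := by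
  simp only [← coe_rot]
  exact (sph.rot a A).2

section TimeDerivative

variable {I : Set ℝ} (hI : IsOpen I) {u : ℝ} (hu : u ∈ I)
include hI

lemma smoothOn_div2 {T : ℝ → S2 → Fin 3 → Fin 3 → ℝ}
    (hT : ∀ A B, SmoothOn I fun s x => T s x A B) (A : Fin 3) :
    SmoothOn I (fun s x => div2 (T s) x A) :=
  SmoothOn.sum fun B _ => SmoothOn.sum fun C _ => SmoothOn.sum fun D _ =>
    ((smooth_metric A C).mul (smooth_metric B D)).smoothOn.mul ((hT C D).grad hI B)

include hu

lemma hasDerivAt_covD1 {v : ℝ → S2 → Fin 3 → ℝ} (hv : ∀ A, SmoothOn I fun s x => v s x A)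
    (x : S2) (A B : Fin 3) : HasDerivAt (fun s => covD1 (v s) x A B)
      (covD1 (fun y C => deriv (fun s => v s y C) u) x A B) u :=
  HasDerivAt.fun_sum fun C _ => ((hv C).hasDerivAt_grad hI hu x B).const_mul _

lemma hasDerivAt_div2 {T : ℝ → S2 → Fin 3 → Fin 3 → ℝ}
    (hT : ∀ A B, SmoothOn I fun s x => T s x A B) (x : S2) (A : Fin 3) :
    HasDerivAt (fun s => div2 (T s) x A)
      (div2 (fun y C D => deriv (fun s => T s y C D) u) x A) u :=
  HasDerivAt.fun_sum fun B _ => HasDerivAt.fun_sum fun C _ => HasDerivAt.fun_sum fun D _ =>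
    ((hT C D).hasDerivAt_grad hI hu x B).const_mul _

variable {F : ℝ → S2 → ℝ} (hF : SmoothOn I F)
include hF

lemma SmoothOn.hasDerivAt_hess (x : S2) (A B : Fin 3) :
    HasDerivAt (fun s => hess (F s) x A B) (hess (fun y => _root_.deriv (fun s => F s y) u) x A B)
      u := by
  refine (hasDerivAt_covD1 hI hu (v := fun s => Scri.grad (F s)) (fun A => hF.grad hI A) x A
    B).congr_deriv (congrArg (covD1 · x A B) (funext₂ fun y C => ?_))
  exact (hF.hasDerivAt_grad hI hu y C).deriv

lemma SmoothOn.hasDerivAt_lap (x : S2) :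
    HasDerivAt (fun s => lap (F s) x) (lap (fun y => _root_.deriv (fun s => F s y) u) x) u :=
  HasDerivAt.fun_sum fun A _ => hF.hasDerivAt_hess hI hu x A A

end TimeDerivative

section Charge

variable {I : Set ℝ} (hI : IsOpen I) {d : ScriData} (hd : IsScriData I d) {u : ℝ} (hu : u ∈ I)
  (a : E3)
include hI hd hu

lemma hasDerivAt_JCJK : HasDerivAt (fun s => JCJK a d s)
    (-(1 / (8 * Real.pi)) * ∫ x, ∑ A, (3 * deriv (fun s => d.N s x A) u + 1 / 4 * ∑ B,
      (d.χdot u x A B * div2 (d.χ u) x B + d.χ u x A B * div2 (d.χdot u) x B)) * rot a x A ∂area)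
    u := by
  have hsmooth : SmoothOn I (fun s x => ∑ A, (3 * d.N s x A
      + 1 / 4 * ∑ B, d.χ s x A B * div2 (d.χ s) x B) * rot a x A) :=
    SmoothOn.sum fun A _ => (((hd.smooth_N A).const_mul 3).add ((SmoothOn.sum fun B _ =>
      (hd.smooth_χ A B).mul (smoothOn_div2 hI hd.smooth_χ B)).const_mul _)).mul
        (smooth_rot a A).smoothOn
  have hquad (x : S2) (A B : Fin 3) : HasDerivAt (fun s => d.χ s x A B * div2 (d.χ s) x B)
      (d.χdot u x A B * div2 (d.χ u) x B + d.χ u x A B * div2 (d.χdot u) x B) u :=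
    ((hd.smooth_χ A B).hasDerivAt hI hu x).mul (hasDerivAt_div2 hI hu hd.smooth_χ x B)
  refine ((hsmooth.hasDerivAt_integral hI hu).const_mul _).congr_deriv ?_
  congr with x
  refine HasDerivAt.deriv ?_
  refine HasDerivAt.fun_sum fun A _ => HasDerivAt.mul_const ?_ _
  exact (((hd.smooth_N A).hasDerivAt hI hu x).const_mul 3).add
    ((HasDerivAt.fun_sum fun B _ => hquad x A B).const_mul _)

lemma hasDerivAt_integral_m_mul_rot {c : ℝ → S2 → ℝ} (hc : SmoothOn I c) :
    HasDerivAt (fun s => ∫ x, d.m s x * ∑ A, rot a x A * grad (c s) x A ∂area)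
      (∫ x, (deriv (fun s => d.m s x) u * ∑ A, rot a x A * grad (c u) x A + d.m u x *
        ∑ A, rot a x A * grad (fun y => deriv (fun s => c s y) u) x A) ∂area) u := by
  have hsmooth : SmoothOn I (fun s x => d.m s x * ∑ A, rot a x A * grad (c s) x A) :=
    hd.smooth_m.mul (SmoothOn.sum fun A _ => (smooth_rot a A).smoothOn.mul (hc.grad hI A))
  refine (hsmooth.hasDerivAt_integral hI hu).congr_deriv ?_
  congr with x
  refine HasDerivAt.deriv ?_
  exact (hd.smooth_m.hasDerivAt hI hu x).mul (HasDerivAt.fun_sum fun A _ =>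
    (hc.hasDerivAt_grad hI hu x A).const_mul _)

end Charge

section ElectricShear

lemma ArePotentials.eq_of_magnetic_eq_zero {T : S2 → Fin 3 → Fin 3 → ℝ} {c b : S2 → ℝ}
    (h : ArePotentials T c b) (hb : ∀ x, b x = 0) (x : S2) (A B : Fin 3) :
    T x A B = 2 * hess c x A B - metric x A B * lap c x := by
  rw [h.eq, show b = fun _ => 0 from funext hb]
  simp [tensorOfPotentials, hess, covD1, grad_const]

lemma χdot_eq_of_χ_eq {I : Set ℝ} (hI : IsOpen I) {d : ScriData} {c : ℝ → S2 → ℝ}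
    (hc : SmoothOn I c) (hχ : ∀ s ∈ I, ∀ x A B,
      d.χ s x A B = 2 * hess (c s) x A B - metric x A B * lap (c s) x)
    {u : ℝ} (hu : u ∈ I) (x : S2) (A B : Fin 3) :
    d.χdot u x A B = 2 * hess (fun y => deriv (fun s => c s y) u) x A B -
      metric x A B * lap (fun y => deriv (fun s => c s y) u) x := by
  refine HasDerivAt.deriv ?_
  refine (((hc.hasDerivAt_hess hI hu x A B).const_mul 2).sub
    ((hc.hasDerivAt_lap hI hu x).const_mul (metric x A B))).congr_of_eventuallyEq ?_
  filter_upwards [hI.mem_nhds hu] with s hs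
  exact hχ s hs x A B

variable {d : ScriData} {u : ℝ} {c e μ : smoothAlg}

lemma lam_eq_zero (hχ : d.χ u = fun x A B => (sph.electric c A B : S2 → ℝ) x) (x : S2) :
    d.lam u x = 0 := by
  have hsum := congrFun (congrArg Subtype.val (sph.sum_ε_mul_covD3_covD2_electric c)) x
  rw [ScriData.lam, hχ]
  simp only [← coe_covDD2, ← coe_ε]
  simpa using hsum

variable {I : Set ℝ} (hev : SatisfiesEvolution I d) (hu : u ∈ I)
  (hχdot : d.χdot u = fun x A B => (sph.electric e A B : S2 → ℝ) x)
include hev hu hχdot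

lemma deriv_m_eq_massRate (x : S2) :
    deriv (fun s => d.m s x) u = (sph.massRate e : S2 → ℝ) x := by
  have hdiv : ∑ A, ∑ B, covDD2 (d.χdot u) x A B B A =
      (sph.lap (sph.lapAddTwo e) : S2 → ℝ) x := by
    rw [← sph.sum_covD3_covD2_tensorOfPotentials e 0, hχdot]
    simp [SphereCalculus.tensorOfPotentials, coe_covDD2]
  rw [hev.m_dot u hu x, hdiv, hχdot]
  simp [SphereCalculus.massRate, Matrix.trace, Matrix.mul_apply,
    (sph.isSTF_electric e).isSymm.apply]

lemma int_mass_density_rate (hm : d.m u = μ) (a : E3) :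
    ∫ x, (deriv (fun s => d.m s x) u * ∑ A, rot a x A * grad c x A +
      d.m u x * ∑ A, rot a x A * grad e x A) ∂area =
    sph.int (sph.massRate e * sph.rotDeriv a c) + sph.int (μ * sph.rotDeriv a e) := by
  rw [← map_add, sph_int_apply]
  congr with x
  rw [deriv_m_eq_massRate hev hu hχdot, hm, ← coe_rotDeriv, ← coe_rotDeriv]
  rfl

variable (hχ : d.χ u = fun x A B => (sph.electric c A B : S2 → ℝ) x)
include hχ

lemma angular_density_rate (hm : d.m u = μ) (x : S2) (A : Fin 3) :
    3 * deriv (fun s => d.N s x A) u + 1 / 4 * ∑ B,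
      (d.χdot u x A B * div2 (d.χ u) x B + d.χ u x A B * div2 (d.χdot u) x B) =
    (sph.angularRate μ c e A : S2 → ℝ) x := by
  have hlam : d.lam u = fun _ => 0 := funext (lam_eq_zero hχ)
  rw [hev.N_dot u hu x, hlam, hm, hχ, hχdot]
  simp only [← coe_div2, ← coe_covD2, grad_const, SphereCalculus.div2_electric]
  simp [SphereCalculus.angularRate, Matrix.mulVec, coe_dotProduct, coe_δ, Finset.sum_add_distrib]
  ring

lemma int_angular_density_rate (hm : d.m u = μ) (a : E3) :
    ∫ x, ∑ A, (3 * deriv (fun s => d.N s x A) u + 1 / 4 * ∑ B,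
      (d.χdot u x A B * div2 (d.χ u) x B + d.χ u x A B * div2 (d.χdot u) x B)) * rot a x A ∂area =
    sph.int (sph.angularRate μ c e ⬝ᵥ sph.rot a) := by
  rw [sph_int_apply]
  congr with x
  simp only [coe_dotProduct, coe_rot, angular_density_rate hev hu hχdot hχ hm]

end ElectricShear

lemma int_flux_density (a : E3) (μ c e : smoothAlg) :
    ∫ x, ∑ A, rot a x A * (3 * (μ : S2 → ℝ) x * grad e x A
      - 3 / 2 * (grad c x A * ∑ B, ∑ C, hess e x B C * hess e x B C)
      + 3 / 4 * (grad c x A * lap e x ^ 2) + 1 / 4 * (grad c x A * lapLap2 e x)) ∂area =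
    sph.int ((3 : ℝ) • (μ * sph.rotDeriv a e) -
        (3 / 2 : ℝ) • (sph.rotDeriv a c * (sph.hess e * sph.hess e).trace) +
        (3 / 4 : ℝ) • (sph.rotDeriv a c * (sph.lap e * sph.lap e)) +
        (1 / 4 : ℝ) • (sph.rotDeriv a c * sph.lap (sph.lapAddTwo e))) := by
  rw [sph_int_apply]
  congr with x
  have htrace : ((sph.hess e * sph.hess e).trace : S2 → ℝ) x =
      ∑ B, ∑ C, hess e x B C * hess e x B C := by
    simp [Matrix.trace, Matrix.mul_apply, ← coe_hess, (sph.hess_isSymm e).apply]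
  generalize ∑ B, ∑ C, hess e x B C * hess e x B C = q at htrace ⊢
  simp [htrace, coe_rotDeriv, coe_lap, ← coe_lap_lapAddTwo, Fin.sum_univ_three]
  ring

variable {I : Set ℝ} {d : ScriData} {c b : ℝ → S2 → ℝ} {u : ℝ}

lemma hasDerivAt_J (hI : IsOpen I) (hd : IsScriData I d) (hev : SatisfiesEvolution I d)
    (hc : SmoothOn I c) (hcb : ∀ s ∈ I, ArePotentials (d.χ s) (c s) (b s))
    (hb : ∀ s ∈ I, ∀ x, b s x = 0) (hu : u ∈ I) (a : E3) :
    HasDerivAt (fun s => J a d s)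
      (1 / (8 * Real.pi) * ∫ x, ∑ A, rot a x A *
        (3 * d.m u x * grad (fun y => deriv (fun s => c s y) u) x A
          - 3 / 2 * (grad (c u) x A * ∑ B, ∑ C, hess (fun y => deriv (fun s => c s y) u) x B C *
              hess (fun y => deriv (fun s => c s y) u) x B C)
          + 3 / 4 * (grad (c u) x A * lap (fun y => deriv (fun s => c s y) u) x ^ 2)
          + 1 / 4 * (grad (c u) x A *
              lapLap2 (fun y => deriv (fun s => c s y) u) x)) ∂area) u := by
  have hχ (s : ℝ) (hs : s ∈ I) (x : S2) (A B : Fin 3) :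
      d.χ s x A B = 2 * hess (c s) x A B - metric x A B * lap (c s) x :=
    (hcb s hs).eq_of_magnetic_eq_zero (hb s hs) x A B
  have hJ : (fun s => J a d s) =ᶠ[𝓝 u] fun s => JWith a d s (c s) :=
    (hI.eventually_mem hu).mono fun s hs =>
      congrArg (JWith a d s) (hcb s hs).electricPotential_eq
  have hJWith : HasDerivAt (fun s => JWith a d s (c s)) _ u := (hasDerivAt_JCJK hI hd hu a).add
    ((hasDerivAt_integral_m_mul_rot hI hd hu a hc).const_mul (3 / (8 * Real.pi)))
  let μ : smoothAlg := ⟨d.m u, hd.smooth_m.smooth hu⟩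
  let C : smoothAlg := ⟨c u, hc.smooth hu⟩
  let E : smoothAlg := ⟨fun y => deriv (fun s => c s y) u, (hc.deriv hI).smooth hu⟩
  have hχu : d.χ u = fun x A B => (sph.electric C A B : S2 → ℝ) x := by
    funext x A B
    rw [coe_electric]
    exact hχ u hu x A B
  have hχdot : d.χdot u = fun x A B => (sph.electric E A B : S2 → ℝ) x := by
    funext x A B
    rw [coe_electric]
    exact χdot_eq_of_χ_eq hI hc hχ hu x A B
  have hangular := int_angular_density_rate (μ := μ) hev hu hχdot hχu rfl a
  have hmass := int_mass_density_rate (c := C) (μ := μ) hev hu hχdot rfl a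
  have hflux := int_flux_density a μ C E
  refine (hJWith.congr_of_eventuallyEq hJ).congr_deriv ?_
  rw [hangular, hmass, hflux, ← sph.int_angular_flux]
  ring

end Scri

end

theorem mainTheorem1 (I : Set ℝ) (hI : IsOpen I) (a : Scri.E3) (d : Scri.ScriData)
    (hd : Scri.IsScriData I d) (c b : ℝ → Scri.S2 → ℝ)
    (hc : Scri.SmoothOn I c) (hb : Scri.SmoothOn I b)
    (hcb : ∀ u ∈ I, Scri.ArePotentials (d.χ u) (c u) (b u)) :
    -- flux of the angular momentum when the potential `b` vanishes
    (Scri.SatisfiesEvolution I d → (∀ u ∈ I, ∀ x, b u x = 0) →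
      ∀ u ∈ I, HasDerivAt (fun s => Scri.J a d s)
        (1 / (8 * Real.pi) * ∫ x, ∑ A, Scri.rot a x A *
          (3 * d.m u x * Scri.grad (fun y => deriv (fun s => c s y) u) x A
            - 3 / 2 * (Scri.grad (c u) x A *
                ∑ B, ∑ C, Scri.hess (fun y => deriv (fun s => c s y) u) x B C *
                  Scri.hess (fun y => deriv (fun s => c s y) u) x B C)
            + 3 / 4 * (Scri.grad (c u) x A *
                Scri.lap (fun y => deriv (fun s => c s y) u) x ^ 2)
            + 1 / 4 * (Scri.grad (c u) x A *
                Scri.lapLap2 (fun y => deriv (fun s => c s y) u) x)) ∂Scri.area) u) ∧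
    -- supertranslations when the shear is stationary
    ((∀ u ∈ I, ∀ x A B, d.χdot u x A B = 0) →
      ∀ f : Scri.S2 → ℝ, Scri.Smooth f → ∀ u ∈ I,
        -- arbitrary `f`, the potential being transformed by `c ↦ c - f`
        Scri.JWith a (d.supertranslate f) u (fun x => c u x - f x) =
            Scri.J a d u + 1 / (32 * Real.pi) *
              ∫ x, f x * ∑ A, Scri.grad (Scri.dipole a) x A *
                Scri.grad (Scri.lapLap2 (b u)) x A ∂Scri.area ∧
        -- `f` without translational part, the potential being that of the transformed shear
        (Scri.NoDipole f →
          Scri.J a (d.supertranslate f) u =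
            Scri.J a d u + 1 / (32 * Real.pi) *
              ∫ x, f x * ∑ A, Scri.grad (Scri.dipole a) x A *
                Scri.grad (Scri.lapLap2 (b u)) x A ∂Scri.area)) := by
  refine ⟨fun hev hb_zero u hu => Scri.hasDerivAt_J hI hd hev hc hcb hb_zero hu a,
    fun hχ f hf u hu => ?_⟩
  have hdot := Scri.ScriData.χdot_eq_zero hχ hu
  have hddot := Scri.ScriData.χddot_eq_zero hI hχ hu
  have hm := hd.smooth_m.smooth hu
  have hN := fun A => (hd.smooth_N A).smooth hu
  exact ⟨Scri.JWith_supertranslate hdot hddot hm hN hf (hcb u hu) a,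
    fun hdipole => Scri.J_supertranslate hdot hddot hm hN hf hdipole (hcb u hu) a⟩
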